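/- Let $X$ be a closed (compact, Hausdorff, without boundary) smooth $m$-manifold. For a smooth immersion $f:X\to\mathbb R^N$ let $curv^\perp_f(X)$ be the supremum of the curvatures in $\mathbb R^N$ of the curves $f\circ\gamma$, where $\gamma$ runs over the geodesics of $X$ for the Riemannian metric induced by $f$ (the supremum is $0$ if there are no unit speed geodesics), and let $min.curv^\perp(X,B^N(1))\in[0,\infty]$ be the infimum of $curv^\perp_f(X)$ over all smooth immersions $f$ of $X$ in $\mathbb R^N$ with image in the closed unit ball $B^N(1)$ (it is $\infty$ if there are none). Then the limit of $min.curv^\perp(X,B^N(1))$ for $N\to\infty$ exists, and $$\lim_{N\to\infty} min.curv^\perp(X,B^N(1))\le\sqrt{\frac{3m}{m+2}}.$$ In particular, if $m\ge 2$, then there is $N_0=N_0(X)$ such that for all $N\ge N_0$ $$min.curv^\perp(X,B^N(1))<\sqrt{\frac{3(2m-1)}{2m+1}}.$$ -/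

import Mathlib

open Filter Set
open scoped Topology Manifold ContDiff ENNReal

/-- A smooth immersion of an `m`-manifold in `ℝ^N`: a smooth map with injective differentials. -/
structure IsSmoothImmersion {m N : ℕ} {X : Type*} [TopologicalSpace X]
    [ChartedSpace (EuclideanSpace ℝ (Fin m)) X] (f : X → EuclideanSpace ℝ (Fin N)) : Prop where
  contMDiff : ContMDiff (𝓡 m) 𝓘(ℝ, EuclideanSpace ℝ (Fin N)) ∞ f
  injective_mfderiv : ∀ x : X,
    Function.Injective (mfderiv (𝓡 m) 𝓘(ℝ, EuclideanSpace ℝ (Fin N)) f x)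

/-- The metric induced on `X` by `f : X → ℝ^N`, read in the preferred chart `φ` at the point `p`:
at the point `y` of the chart domain `⊆ ℝ^m`, on the vectors `v, w ∈ ℝ^m`, it is
`⟨D(f ∘ φ⁻¹)_y v, D(f ∘ φ⁻¹)_y w⟩`. -/
noncomputable def inducedMetric {m N : ℕ} {X : Type*} [TopologicalSpace X]
    [ChartedSpace (EuclideanSpace ℝ (Fin m)) X] (f : X → EuclideanSpace ℝ (Fin N)) (p : X)
    (y v w : EuclideanSpace ℝ (Fin m)) : ℝ :=
  inner ℝ (fderiv ℝ (f ∘ (chartAt (EuclideanSpace ℝ (Fin m)) p).symm) y v)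
    (fderiv ℝ (f ∘ (chartAt (EuclideanSpace ℝ (Fin m)) p).symm) y w)

/-- `γ`, restricted to the open interval `(a, b)`, is a unit speed geodesic of the metric induced
by `f`. If `u` is the curve `γ` in the preferred chart at `γ t` and `g` is the induced metric in
this chart, then `g(u', u') = 1` and `u` satisfies the geodesic equation (the Euler-Lagrange
equation of the energy) `d/dt g_u(u', w) = (1/2) (∂_w g)_u(u', u')` for all `w ∈ ℝ^m`. -/
structure IsUnitSpeedGeodesic {m N : ℕ} {X : Type*} [TopologicalSpace X]
    [ChartedSpace (EuclideanSpace ℝ (Fin m)) X] (f : X → EuclideanSpace ℝ (Fin N))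
    (γ : ℝ → X) (a b : ℝ) : Prop where
  contMDiffOn : ContMDiffOn 𝓘(ℝ, ℝ) (𝓡 m) ∞ γ (Ioo a b)
  unit_speed : ∀ t ∈ Ioo a b,
    let u : ℝ → EuclideanSpace ℝ (Fin m) := chartAt (EuclideanSpace ℝ (Fin m)) (γ t) ∘ γ
    inducedMetric (m := m) f (γ t) (u t) (deriv u t) (deriv u t) = 1
  geodesic_equation : ∀ t ∈ Ioo a b,
    let u : ℝ → EuclideanSpace ℝ (Fin m) := chartAt (EuclideanSpace ℝ (Fin m)) (γ t) ∘ γ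
    ∀ w : EuclideanSpace ℝ (Fin m),
      deriv (fun s => inducedMetric (m := m) f (γ t) (u s) (deriv u s) w) t =
        (1 / 2) * fderiv ℝ (fun y => inducedMetric (m := m) f (γ t) y (deriv u t) (deriv u t)) (u t) w

/-- The curvature of an immersion `f : X → ℝ^N`: the supremum of the curvatures `‖(f ∘ γ)''‖` in
`ℝ^N` of the unit speed geodesics `γ` of the induced metric. (If `γ` has unit speed for the induced
metric, then `f ∘ γ` is parametrized by arc length.) -/
noncomputable def curvPerp {m N : ℕ} {X : Type*} [TopologicalSpace X]
    [ChartedSpace (EuclideanSpace ℝ (Fin m)) X] (f : X → EuclideanSpace ℝ (Fin N)) : ℝ≥0∞ :=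
  ⨆ (γ : ℝ → X) (a : ℝ) (b : ℝ) (_ : IsUnitSpeedGeodesic (m := m) f γ a b) (t : ℝ) (_ : t ∈ Ioo a b),
    ENNReal.ofReal ‖deriv (deriv (f ∘ γ)) t‖

/-- The infimum of the curvatures of the smooth immersions of `X` in the unit ball of `ℝ^N`
(it is `∞` if there is no such immersion). -/
noncomputable def minCurvPerp (m : ℕ) (X : Type*) [TopologicalSpace X]
    [ChartedSpace (EuclideanSpace ℝ (Fin m)) X] (N : ℕ) : ℝ≥0∞ :=
  ⨅ (f : X → EuclideanSpace ℝ (Fin N)) (_ : IsSmoothImmersion (m := m) f)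
    (_ : ∀ x, f x ∈ Metric.closedBall (0 : EuclideanSpace ℝ (Fin N)) 1), curvPerp (m := m) f

/-!
For every `δ > 0` there is an immersion of `X` in a unit sphere with curvature at most
`√(3m/(m+2)) + δ`; since a linear isometry `ℝ^N → ℝ^(N+1)` preserves curvature, the minimal
curvature is antitone in `N`, and the limit exists and is at most `√(3m/(m+2))`.

**The model.** Let `ξ k` be unit vectors of `ℝ^m` with weights `a k ^ 2` of sum `1` that have the
second and fourth moments of the uniform measure on the sphere (`exists_spherical_design`):
`∑ a² ⟨ξ, v⟩² = |v|² / m` and `∑ a² ⟨ξ, v⟩⁴ = 3 |v|⁴ / (m (m + 2))`. The map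
`y ↦ (a k * exp (i lam ⟨ξ k, y⟩))_k` of `ℝ^m` to the unit sphere maps a straight line with velocity
`v` to a curve with speed `lam |v| / √m` and acceleration `lam² |v|² √(3 / (m (m + 2)))`, so that
its curvature is `√(3m/(m+2))`.

**Globalization.** Start with a Whitney embedding `e : X → ℝ^q`. Near each point `p`, the orthogonal
projection `L p : ℝ^q → ℝ^m` to the tangent space at `p` is almost isometric on the tangent spaces
of `X` (`exists_contraction_almost_isometric`). Take functions `χ j` with `∑ χ j ^ 2 = 1`, each
supported in such a neighbourhood (`exists_sq_partition_of_unity`), and put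
`f = (a k * χ j * exp (i lam ⟨ξ k, L j e⟩))_{j,k}` (`oscillatingMap`). The terms of top order in
`lam` are weighted averages of those of the model, and the other ones become negligible for
`lam → ∞`: `le_norm_deriv_oscillatingMap_sq` bounds the speed from below, which makes `f` an
immersion, and
`norm_deriv_deriv_oscillatingMap_le` bounds the acceleration from above.

**Geodesics.** By the geodesic equation the acceleration of a geodesic in `ℝ^N` is normal to the
immersed manifold, and hence at most the acceleration of any curve on `X` with the same velocity
(`IsUnitSpeedGeodesic.exists_norm_deriv_deriv_le`). So only straight lines in charts matter. As the
given charts are arbitrary, the comparison uses finitely many of them, which makes the bounds on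
derivatives uniform (`exists_uniform_bound_chartLine`).

For `m ≥ 2` the number `√(3(2m-1)/(2m+1))` exceeds the bound on the limit, since
`m (2m + 1) < (2m - 1) (m + 2)` for `m > 1`, so the minimal curvature is eventually below it.

In dimension `0` there are no unit speed geodesics and a constant map is an immersion
(`minCurvPerp_zero`).
-/

/-! ### Calculus along curves -/

section Calculus

variable {E F : Type*} [NormedAddCommGroup E] [NormedSpace ℝ E]
  [NormedAddCommGroup F] [NormedSpace ℝ F]

theorem eventually_deriv_comp_eq {g : E → F} {u : ℝ → E} {t : ℝ}
    (hg : ContDiffAt ℝ 2 g (u t)) (hu : ContDiffAt ℝ 2 u t) :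
    ∀ᶠ s in 𝓝 t, deriv (g ∘ u) s = fderiv ℝ g (u s) (deriv u s) := by
  filter_upwards [hu.continuousAt.eventually (hg.eventually (by simp)),
    hu.eventually (by simp)] with s hs hs'
  exact fderiv_comp_deriv s (hs.differentiableAt (by simp)) (hs'.differentiableAt (by simp))

/-- The second derivative of a map along a curve. -/
theorem hasDerivAt_deriv_comp {g : E → F} {u : ℝ → E} {t : ℝ}
    (hg : ContDiffAt ℝ 2 g (u t)) (hu : ContDiffAt ℝ 2 u t) :
    HasDerivAt (deriv (g ∘ u)) (fderiv ℝ (fderiv ℝ g) (u t) (deriv u t) (deriv u t) +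
      fderiv ℝ g (u t) (deriv (deriv u) t)) t := by
  have h1 : HasDerivAt (fun s => fderiv ℝ g (u s))
      (fderiv ℝ (fderiv ℝ g) (u t) (deriv u t)) t := by
    have h2 : DifferentiableAt ℝ (fderiv ℝ g) (u t) :=
      (hg.fderiv_right (m := 1) (by norm_num)).differentiableAt (by simp)
    exact h2.hasFDerivAt.comp_hasDerivAt t (hu.differentiableAt (by simp)).hasDerivAt
  have h3 : HasDerivAt (deriv u) (deriv (deriv u) t) t :=
    ((hu.derivWithin (m := 1) (by norm_num)).differentiableAt (by simp)).hasDerivAt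
  exact (h1.clm_apply h3).congr_of_eventuallyEq (eventually_deriv_comp_eq hg hu)

theorem deriv_comp_line {g : E → F} {y : E} (v : E) (hg : DifferentiableAt ℝ g y) :
    deriv (fun s : ℝ => g (y + s • v)) 0 = fderiv ℝ g y v := by
  have h : HasDerivAt (fun s : ℝ => y + s • v) v 0 := by
    simpa using ((hasDerivAt_id (0 : ℝ)).smul_const v).const_add y
  have h0 : y + (0 : ℝ) • v = y := by simp
  have hg' : HasFDerivAt g (fderiv ℝ g y) (y + (0 : ℝ) • v) := by
    rw [h0]; exact hg.hasFDerivAt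
  exact (hg'.comp_hasDerivAt 0 h).deriv

theorem deriv_deriv_comp_line {g : E → F} {y : E} (v : E) (hg : ContDiffAt ℝ 2 g y) :
    deriv (deriv (fun s : ℝ => g (y + s • v))) 0 = fderiv ℝ (fderiv ℝ g) y v v := by
  have h0 : y + (0 : ℝ) • v = y := by simp
  have hd : deriv (fun s : ℝ => y + s • v) = fun _ => v := by
    funext s
    simpa only [id_eq, one_smul] using (((hasDerivAt_id s).smul_const v).const_add y).deriv
  have := (hasDerivAt_deriv_comp (g := g) (u := fun s : ℝ => y + s • v) (t := 0)
    (by rw [h0]; exact hg) (by fun_prop)).deriv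
  simpa only [hd, h0, Function.comp_def, deriv_const, map_zero, add_zero] using this

end Calculus

/-! ### Functions and curves in charts -/

section Charts

variable {m : ℕ} {X : Type*} [TopologicalSpace X] [ChartedSpace (EuclideanSpace ℝ (Fin m)) X]

theorem comp_eventuallyEq_comp_chartAt {γ : ℝ → X} {t : ℝ} (hγ : ContinuousAt γ t) {p : X}
    (hp : γ t ∈ (chartAt (EuclideanSpace ℝ (Fin m)) p).source) {F : Type*} (h : X → F) :
    h ∘ γ =ᶠ[𝓝 t] (h ∘ (chartAt (EuclideanSpace ℝ (Fin m)) p).symm) ∘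
      (chartAt (EuclideanSpace ℝ (Fin m)) p ∘ γ) := by
  filter_upwards [hγ.eventually
    ((chartAt (EuclideanSpace ℝ (Fin m)) p).open_source.mem_nhds hp)] with s hs
  simp [(chartAt (EuclideanSpace ℝ (Fin m)) p).left_inv hs]

variable {F : Type*} [NormedAddCommGroup F] [NormedSpace ℝ F] [IsManifold (𝓡 m) ∞ X]

theorem contDiffAt_comp_chartAt_symm {h : X → F} (hh : ContMDiff (𝓡 m) 𝓘(ℝ, F) ∞ h) {p : X}
    {y : EuclideanSpace ℝ (Fin m)} (hy : y ∈ (chartAt (EuclideanSpace ℝ (Fin m)) p).target) :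
    ContDiffAt ℝ ∞ (h ∘ (chartAt (EuclideanSpace ℝ (Fin m)) p).symm) y := by
  have h1 := (contMDiffOn_chart_symm (I := 𝓡 m) (n := ∞) (x := p)).contMDiffAt
    ((chartAt (EuclideanSpace ℝ (Fin m)) p).open_target.mem_nhds hy)
  exact (hh.contMDiffAt.comp y h1).contDiffAt

theorem contDiffAt_chartAt_comp {γ : ℝ → X} {t : ℝ} (hγ : ContMDiffAt 𝓘(ℝ, ℝ) (𝓡 m) ∞ γ t) {p : X}
    (hp : γ t ∈ (chartAt (EuclideanSpace ℝ (Fin m)) p).source) :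
    ContDiffAt ℝ ∞ (chartAt (EuclideanSpace ℝ (Fin m)) p ∘ γ) t := by
  have h1 := (contMDiffOn_chart (I := 𝓡 m) (n := ∞) (x := p)).contMDiffAt
    ((chartAt (EuclideanSpace ℝ (Fin m)) p).open_source.mem_nhds hp)
  exact (h1.comp t hγ).contDiffAt

/-- The differential of a function at a point, read in two charts: the coordinate change carries
one to the other, so that the image of the differential does not depend on the chart. -/
theorem fderiv_comp_chartAt_symm_eq {h : X → F} (hh : ContMDiff (𝓡 m) 𝓘(ℝ, F) ∞ h) {p q x : X}
    (hp : x ∈ (chartAt (EuclideanSpace ℝ (Fin m)) p).source)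
    (hq : x ∈ (chartAt (EuclideanSpace ℝ (Fin m)) q).source) (v : EuclideanSpace ℝ (Fin m)) :
    fderiv ℝ (h ∘ (chartAt (EuclideanSpace ℝ (Fin m)) p).symm)
        (chartAt (EuclideanSpace ℝ (Fin m)) p x) v =
      fderiv ℝ (h ∘ (chartAt (EuclideanSpace ℝ (Fin m)) q).symm)
        (chartAt (EuclideanSpace ℝ (Fin m)) q x)
        (fderiv ℝ (chartAt (EuclideanSpace ℝ (Fin m)) q ∘
            (chartAt (EuclideanSpace ℝ (Fin m)) p).symm)
          (chartAt (EuclideanSpace ℝ (Fin m)) p x) v) := by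
  set φ := chartAt (EuclideanSpace ℝ (Fin m)) p with hφ
  set ψ := chartAt (EuclideanSpace ℝ (Fin m)) q with hψ
  have hy : φ x ∈ φ.target := φ.map_source hp
  have hsymm : ContMDiffAt (𝓡 m) (𝓡 m) ∞ φ.symm (φ x) :=
    (contMDiffOn_chart_symm (I := 𝓡 m) (n := ∞) (x := p)).contMDiffAt (φ.open_target.mem_nhds hy)
  have hx : φ.symm (φ x) = x := φ.left_inv hp
  have h1 : ContDiffAt ℝ ∞ (ψ ∘ φ.symm) (φ x) := by
    have h2 : ContMDiffAt (𝓡 m) (𝓡 m) ∞ ψ (φ.symm (φ x)) := by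
      rw [hx]
      exact (contMDiffOn_chart (I := 𝓡 m) (n := ∞) (x := q)).contMDiffAt
        (ψ.open_source.mem_nhds hq)
    exact (h2.comp (φ x) hsymm).contDiffAt
  have hψx : (ψ ∘ φ.symm) (φ x) = ψ x := by simp [hx]
  have h3 : DifferentiableAt ℝ (h ∘ ψ.symm) ((ψ ∘ φ.symm) (φ x)) := by
    rw [hψx]
    exact (contDiffAt_comp_chartAt_symm hh (ψ.map_source hq)).differentiableAt (by simp)
  have h4 : h ∘ φ.symm =ᶠ[𝓝 (φ x)] (h ∘ ψ.symm) ∘ (ψ ∘ φ.symm) := by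
    have : ∀ᶠ y in 𝓝 (φ x), φ.symm y ∈ ψ.source :=
      hsymm.continuousAt.eventually (ψ.open_source.mem_nhds (by rw [hx]; exact hq))
    filter_upwards [this] with y hy
    simp [ψ.left_inv hy]
  rw [h4.fderiv_eq, fderiv_comp _ h3 (h1.differentiableAt (by simp)), hψx]
  rfl

end Charts

/-! ### The acceleration of geodesics -/

section Geodesics

variable {m N : ℕ} {X : Type*} [TopologicalSpace X] [ChartedSpace (EuclideanSpace ℝ (Fin m)) X]
  [IsManifold (𝓡 m) ∞ X] {f : X → EuclideanSpace ℝ (Fin N)} {γ : ℝ → X} {a b t : ℝ}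

/-- The geodesic equation says that the acceleration in `ℝ^N` of a geodesic is normal to the
immersed manifold. -/
theorem IsUnitSpeedGeodesic.inner_deriv_deriv_eq_zero
    (hf : ContMDiff (𝓡 m) 𝓘(ℝ, EuclideanSpace ℝ (Fin N)) ∞ f)
    (hγ : IsUnitSpeedGeodesic (m := m) f γ a b) (ht : t ∈ Ioo a b)
    (w : EuclideanSpace ℝ (Fin m)) :
    inner ℝ (deriv (deriv (f ∘ γ)) t)
      (fderiv ℝ (f ∘ (chartAt (EuclideanSpace ℝ (Fin m)) (γ t)).symm)
        (chartAt (EuclideanSpace ℝ (Fin m)) (γ t) (γ t)) w) = 0 := by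
  have hγt : ContMDiffAt 𝓘(ℝ, ℝ) (𝓡 m) ∞ γ t :=
    hγ.contMDiffOn.contMDiffAt (isOpen_Ioo.mem_nhds ht)
  have hsrc := mem_chart_source (EuclideanSpace ℝ (Fin m)) (γ t)
  have hgeo := hγ.geodesic_equation t ht w
  have hev := comp_eventuallyEq_comp_chartAt hγt.continuousAt hsrc f
  have hu := contDiffAt_chartAt_comp hγt hsrc
  have hG := contDiffAt_comp_chartAt_symm hf
    ((chartAt (EuclideanSpace ℝ (Fin m)) (γ t)).map_source hsrc)
  simp only [inducedMetric] at hgeo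
  have hGu : (chartAt (EuclideanSpace ℝ (Fin m)) (γ t)) (γ t) =
    (chartAt (EuclideanSpace ℝ (Fin m)) (γ t) ∘ γ) t := rfl
  rw [hGu] at hG ⊢
  generalize (chartAt (EuclideanSpace ℝ (Fin m)) (γ t) ∘ γ) = u at *
  generalize f ∘ (chartAt (EuclideanSpace ℝ (Fin m)) (γ t)).symm = G at *
  have hG2 : ContDiffAt ℝ 2 G (u t) := hG.of_le ENat.LEInfty.out
  have hu2 : ContDiffAt ℝ 2 u t := hu.of_le ENat.LEInfty.out
  have hD : HasFDerivAt (fderiv ℝ G) (fderiv ℝ (fderiv ℝ G) (u t)) (u t) :=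
    ((hG2.fderiv_right (m := 1) (by norm_num)).differentiableAt (by simp)).hasFDerivAt
  have hacc := (hasDerivAt_deriv_comp hG2 hu2)
  have hvel := eventually_deriv_comp_eq hG2 hu2
  have hDw : HasDerivAt (fun s => fderiv ℝ G (u s) w)
      (fderiv ℝ (fderiv ℝ G) (u t) (deriv u t) w) t := by
    simpa using (hD.comp_hasDerivAt t (hu2.differentiableAt (by simp)).hasDerivAt).clm_apply
      (hasDerivAt_const t w)
  -- The left-hand side of the geodesic equation.
  have hL : deriv (fun s => inner ℝ (fderiv ℝ G (u s) (deriv u s)) (fderiv ℝ G (u s) w)) t =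
      inner ℝ (deriv (G ∘ u) t) (fderiv ℝ (fderiv ℝ G) (u t) (deriv u t) w) +
        inner ℝ (deriv (deriv (G ∘ u)) t) (fderiv ℝ G (u t) w) := by
    rw [← (hacc.differentiableAt.hasDerivAt.inner ℝ hDw).deriv]
    apply EventuallyEq.deriv_eq
    filter_upwards [hvel] with s hs
    rw [hs]
  -- The right-hand side of the geodesic equation.
  have hR : fderiv ℝ (fun y => inner ℝ (fderiv ℝ G y (deriv u t)) (fderiv ℝ G y (deriv u t)))
      (u t) w = 2 * inner ℝ (deriv (G ∘ u) t)
        (fderiv ℝ (fderiv ℝ G) (u t) w (deriv u t)) := by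
    have h1 : HasFDerivAt (fun y => fderiv ℝ G y (deriv u t))
        ((fderiv ℝ (fderiv ℝ G) (u t)).flip (deriv u t)) (u t) := by
      simpa using hD.clm_apply (hasFDerivAt_const (deriv u t) (u t))
    rw [(h1.inner ℝ h1).fderiv, hvel.self_of_nhds]
    simp [real_inner_comm, two_mul]
  have hsymm : fderiv ℝ (fderiv ℝ G) (u t) w (deriv u t) =
      fderiv ℝ (fderiv ℝ G) (u t) (deriv u t) w :=
    (hG2.isSymmSndFDerivAt (by simp)) w (deriv u t)
  rw [hL, hR, hsymm] at hgeo
  rw [hev.deriv.deriv_eq]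
  linarith

/-- Among the curves with a given velocity, geodesics have the smallest acceleration: the curvature
of a geodesic is at most the acceleration of a straight line in any chart that has the same
velocity. -/
theorem IsUnitSpeedGeodesic.exists_norm_deriv_deriv_le
    (hf : ContMDiff (𝓡 m) 𝓘(ℝ, EuclideanSpace ℝ (Fin N)) ∞ f)
    (hγ : IsUnitSpeedGeodesic (m := m) f γ a b) (ht : t ∈ Ioo a b) {p : X}
    (hp : γ t ∈ (chartAt (EuclideanSpace ℝ (Fin m)) p).source) :
    ∃ v, ‖fderiv ℝ (f ∘ (chartAt (EuclideanSpace ℝ (Fin m)) p).symm)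
        (chartAt (EuclideanSpace ℝ (Fin m)) p (γ t)) v‖ = 1 ∧
      ‖deriv (deriv (f ∘ γ)) t‖ ≤
        ‖fderiv ℝ (fderiv ℝ (f ∘ (chartAt (EuclideanSpace ℝ (Fin m)) p).symm))
          (chartAt (EuclideanSpace ℝ (Fin m)) p (γ t)) v v‖ := by
  have hγt : ContMDiffAt 𝓘(ℝ, ℝ) (𝓡 m) ∞ γ t :=
    hγ.contMDiffOn.contMDiffAt (isOpen_Ioo.mem_nhds ht)
  have hsrc := mem_chart_source (EuclideanSpace ℝ (Fin m)) (γ t)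
  -- The first two derivatives of `f ∘ γ` in the chart at `p`.
  have key : ∀ {p : X}, γ t ∈ (chartAt (EuclideanSpace ℝ (Fin m)) p).source →
      deriv (f ∘ γ) t = fderiv ℝ (f ∘ (chartAt (EuclideanSpace ℝ (Fin m)) p).symm)
        (chartAt (EuclideanSpace ℝ (Fin m)) p (γ t))
        (deriv (chartAt (EuclideanSpace ℝ (Fin m)) p ∘ γ) t) ∧
      deriv (deriv (f ∘ γ)) t =
        fderiv ℝ (fderiv ℝ (f ∘ (chartAt (EuclideanSpace ℝ (Fin m)) p).symm))
          (chartAt (EuclideanSpace ℝ (Fin m)) p (γ t))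
          (deriv (chartAt (EuclideanSpace ℝ (Fin m)) p ∘ γ) t)
          (deriv (chartAt (EuclideanSpace ℝ (Fin m)) p ∘ γ) t) +
        fderiv ℝ (f ∘ (chartAt (EuclideanSpace ℝ (Fin m)) p).symm)
          (chartAt (EuclideanSpace ℝ (Fin m)) p (γ t))
          (deriv (deriv (chartAt (EuclideanSpace ℝ (Fin m)) p ∘ γ)) t) := by
    intro p hp
    have hev := comp_eventuallyEq_comp_chartAt hγt.continuousAt hp f
    have hu : ContDiffAt ℝ 2 _ t :=
      (contDiffAt_chartAt_comp hγt hp).of_le ENat.LEInfty.out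
    have hG : ContDiffAt ℝ 2 _ ((chartAt (EuclideanSpace ℝ (Fin m)) p ∘ γ) t) :=
      (contDiffAt_comp_chartAt_symm hf
        ((chartAt (EuclideanSpace ℝ (Fin m)) p).map_source hp)).of_le ENat.LEInfty.out
    rw [hev.deriv.deriv_eq, hev.deriv_eq]
    exact ⟨(eventually_deriv_comp_eq hG hu).self_of_nhds, (hasDerivAt_deriv_comp hG hu).deriv⟩
  refine ⟨deriv (chartAt (EuclideanSpace ℝ (Fin m)) p ∘ γ) t, ?_, ?_⟩
  · have h1 := hγ.unit_speed t ht
    simp only [inducedMetric, real_inner_self_eq_norm_sq, Function.comp_apply] at h1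
    rw [← (key hp).1, (key hsrc).1]
    exact (pow_eq_one_iff_of_nonneg (norm_nonneg _) two_ne_zero).1 h1
  · set A := deriv (deriv (f ∘ γ)) t with hA
    have hdec := (key hp).2
    -- The component of the acceleration that depends on `γ''` is tangent to the immersed manifold.
    have horth := hγ.inner_deriv_deriv_eq_zero hf ht
      (fderiv ℝ (chartAt (EuclideanSpace ℝ (Fin m)) (γ t) ∘
            (chartAt (EuclideanSpace ℝ (Fin m)) p).symm)
          (chartAt (EuclideanSpace ℝ (Fin m)) p (γ t))
          (deriv (deriv (chartAt (EuclideanSpace ℝ (Fin m)) p ∘ γ)) t))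
    rw [← fderiv_comp_chartAt_symm_eq hf hp hsrc] at horth
    set B := fderiv ℝ (fderiv ℝ (f ∘ (chartAt (EuclideanSpace ℝ (Fin m)) p).symm))
          (chartAt (EuclideanSpace ℝ (Fin m)) p (γ t))
          (deriv (chartAt (EuclideanSpace ℝ (Fin m)) p ∘ γ) t)
          (deriv (chartAt (EuclideanSpace ℝ (Fin m)) p ∘ γ) t) with hB
    have h2 : ‖A‖ * ‖A‖ ≤ ‖A‖ * ‖B‖ := by
      calc ‖A‖ * ‖A‖ = inner ℝ A A := (real_inner_self_eq_norm_mul_norm A).symm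
        _ = inner ℝ A B := by
          conv_lhs => rw [hdec, inner_add_right, ← hdec]
          rw [horth, add_zero]
        _ ≤ ‖A‖ * ‖B‖ := real_inner_le_norm A B
    rcases (norm_nonneg A).eq_or_lt with h0 | h0
    · rw [← h0]; exact norm_nonneg _
    · exact le_of_mul_le_mul_left h2 h0

end Geodesics

/-! ### A spherical 4-design in every dimension -/

section Design

/-- The second moment of a Rademacher sum. -/
theorem sum_sign_sum_sq (n : ℕ) (v : Fin n → ℝ) :
    ∑ σ : Fin n → Bool, (∑ i, (if σ i then 1 else -1) * v i) ^ 2 = 2 ^ n * ∑ i, v i ^ 2 := by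
  induction n with
  | zero => simp
  | succ n ih =>
    rw [← (Fin.consEquiv fun _ => Bool).sum_comp, Fintype.sum_prod_type]
    simp only [Fintype.sum_bool, Fin.consEquiv_apply, Fin.sum_univ_succ, Fin.cons_zero,
      Fin.cons_succ, if_true, Bool.false_eq_true, if_false]
    rw [← Finset.sum_add_distrib]
    have h : ∀ S : ℝ, (1 * v 0 + S) ^ 2 + (-1 * v 0 + S) ^ 2 =
        2 * v 0 ^ 2 + 2 * S ^ 2 := by
      intro S; ring
    simp only [h, Finset.sum_add_distrib, ← Finset.mul_sum, ih, Finset.sum_const,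
      Finset.card_univ, Fintype.card_pi_const, Fintype.card_bool, nsmul_eq_mul]
    push_cast; ring

/-- The fourth moment of a Rademacher sum. -/
theorem sum_sign_sum_pow_four (n : ℕ) (v : Fin n → ℝ) :
    ∑ σ : Fin n → Bool, (∑ i, (if σ i then 1 else -1) * v i) ^ 4 =
      2 ^ n * (3 * (∑ i, v i ^ 2) ^ 2 - 2 * ∑ i, v i ^ 4) := by
  induction n with
  | zero => simp
  | succ n ih =>
    rw [← (Fin.consEquiv fun _ => Bool).sum_comp, Fintype.sum_prod_type]
    simp only [Fintype.sum_bool, Fin.consEquiv_apply, Fin.sum_univ_succ, Fin.cons_zero,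
      Fin.cons_succ, if_true, Bool.false_eq_true, if_false]
    rw [← Finset.sum_add_distrib]
    have h : ∀ S : ℝ, (1 * v 0 + S) ^ 4 + (-1 * v 0 + S) ^ 4 =
        2 * v 0 ^ 4 + 12 * v 0 ^ 2 * S ^ 2 + 2 * S ^ 4 := by
      intro S; ring
    simp only [h, Finset.sum_add_distrib, ← Finset.mul_sum, ih, sum_sign_sum_sq, Finset.sum_const,
      Finset.card_univ, Fintype.card_pi_const, Fintype.card_bool, nsmul_eq_mul]
    push_cast; ring

/-- There is a weighted spherical 4-design in every dimension: finitely many unit vectors `ξ k` with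
weights `(a k) ^ 2` that have the same moments of orders `0`, `2` and `4` as the uniform
probability measure on the unit sphere. -/
theorem exists_spherical_design {m : ℕ} (hm : 0 < m) :
    ∃ (K : Type) (_ : Fintype K) (a : K → ℝ) (ξ : K → EuclideanSpace ℝ (Fin m)),
      (∀ k, ‖ξ k‖ = 1) ∧ ∑ k, a k ^ 2 = 1 ∧
      (∀ v, ∑ k, a k ^ 2 * inner ℝ (ξ k) v ^ 2 = ‖v‖ ^ 2 / m) ∧
      ∀ v, ∑ k, a k ^ 2 * inner ℝ (ξ k) v ^ 4 = 3 * ‖v‖ ^ 4 / (m * (m + 2)) := by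
  have hm' : (0 : ℝ) < m := by exact_mod_cast hm
  have hsm : Real.sqrt m ≠ 0 := (Real.sqrt_pos.2 hm').ne'
  have hs2 : Real.sqrt m ^ 2 = m := Real.sq_sqrt hm'.le
  have hs4 : Real.sqrt m ^ 4 = (m : ℝ) ^ 2 := by
    rw [show (4 : ℕ) = 2 * 2 from rfl, pow_mul, hs2]
  -- The normalized sign vectors, and the standard basis vectors to correct their fourth moment.
  have ha1 : Real.sqrt (m / ((m + 2) * 2 ^ m)) ^ 2 = m / ((m + 2) * 2 ^ m) :=
    Real.sq_sqrt (by positivity)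
  have ha2 : Real.sqrt (2 / (m * (m + 2))) ^ 2 = 2 / (m * (m + 2)) := Real.sq_sqrt (by positivity)
  have hin1 : ∀ (σ : Fin m → Bool) (v : EuclideanSpace ℝ (Fin m)),
      inner ℝ ((Real.sqrt m)⁻¹ • WithLp.toLp 2 fun i => if σ i then (1 : ℝ) else -1) v =
        (Real.sqrt m)⁻¹ * ∑ i, (if σ i then 1 else -1) * v i := by
    intro σ v
    rw [real_inner_smul_left, PiLp.inner_apply]
    simp [mul_comm]
  have hin2 : ∀ (i : Fin m) (v : EuclideanSpace ℝ (Fin m)),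
      inner ℝ (EuclideanSpace.single i (1 : ℝ)) v = v i := by
    intro i v; simp [EuclideanSpace.inner_single_left]
  refine ⟨(Fin m → Bool) ⊕ Fin m, inferInstance,
    Sum.elim (fun _ => Real.sqrt (m / ((m + 2) * 2 ^ m))) (fun _ => Real.sqrt (2 / (m * (m + 2)))),
    Sum.elim (fun σ => (Real.sqrt m)⁻¹ • WithLp.toLp 2 fun i => if σ i then (1 : ℝ) else -1)
      (fun i => EuclideanSpace.single i (1 : ℝ)), ?_, ?_, ?_, ?_⟩
  · rintro (σ | i)
    · have h1 : ‖(WithLp.toLp 2 fun i => if σ i then (1 : ℝ) else -1 :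
          EuclideanSpace ℝ (Fin m))‖ = Real.sqrt m := by
        rw [EuclideanSpace.norm_eq]
        congr 1
        simp
      simp only [Sum.elim_inl, norm_smul, h1, norm_inv, Real.norm_eq_abs,
        abs_of_nonneg (Real.sqrt_nonneg _)]
      field_simp
    · simp
  · simp only [Fintype.sum_sum_type, Sum.elim_inl, Sum.elim_inr, ha1, ha2, Finset.sum_const,
      Finset.card_univ, Fintype.card_pi_const, Fintype.card_bool, Fintype.card_fin, nsmul_eq_mul]
    push_cast
    field_simp
  · intro v
    simp only [Fintype.sum_sum_type, Sum.elim_inl, Sum.elim_inr, ha1, ha2, hin1, hin2, mul_pow,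
      ← Finset.mul_sum, sum_sign_sum_sq, inv_pow, hs2, EuclideanSpace.real_norm_sq_eq]
    field_simp
  · intro v
    rw [show ‖v‖ ^ 4 = (‖v‖ ^ 2) ^ 2 by ring]
    simp only [Fintype.sum_sum_type, Sum.elim_inl, Sum.elim_inr, ha1, ha2, hin1, hin2, mul_pow,
      ← Finset.mul_sum, sum_sign_sum_pow_four, inv_pow, hs4, EuclideanSpace.real_norm_sq_eq]
    field_simp
    ring

end Design

/-! ### Almost isometric projections and local bounds -/

section LinearAlgebra

/-- The orthogonal projection to the image of an injective linear map, identified with `ℝ^m`. -/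
theorem exists_contraction_isometric_on_range {m : ℕ} {F : Type*} [NormedAddCommGroup F]
    [InnerProductSpace ℝ F] (A : EuclideanSpace ℝ (Fin m) →L[ℝ] F) (hA : Function.Injective A) :
    ∃ L : F →L[ℝ] EuclideanSpace ℝ (Fin m),
      (∀ w, ‖L w‖ ≤ ‖w‖) ∧ ∀ v, ‖L (A v)‖ = ‖A v‖ := by
  set S : Submodule ℝ F := LinearMap.range (A : EuclideanSpace ℝ (Fin m) →ₗ[ℝ] F) with hS
  have hdim : Module.finrank ℝ S = m := by
    rw [hS, LinearMap.finrank_range_of_inj hA, finrank_euclideanSpace_fin]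
  set I := ((stdOrthonormalBasis ℝ S).reindex (finCongr hdim)).repr with hI
  refine ⟨I.toLinearIsometry.toContinuousLinearMap ∘L S.orthogonalProjectionOnto, ?_, ?_⟩
  · intro w
    simpa using S.norm_orthogonalProjectionOnto_apply_le w
  · intro v
    have hv : A v ∈ S := ⟨v, rfl⟩
    simp only [ContinuousLinearMap.comp_apply, LinearIsometry.coe_toContinuousLinearMap,
      LinearIsometryEquiv.coe_toLinearIsometry, LinearIsometryEquiv.norm_map]
    rw [show S.orthogonalProjectionOnto (A v) = ⟨A v, hv⟩ from
      S.orthogonalProjectionOnto_mem_subspace_eq_self ⟨A v, hv⟩]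
    rfl

variable {E F G : Type*} [NormedAddCommGroup E] [NormedSpace ℝ E] [FiniteDimensional ℝ E]
  [NormedAddCommGroup F] [NormedSpace ℝ F] [NormedAddCommGroup G] [NormedSpace ℝ G]

/-- Injectivity of the differential is stable, with a locally uniform lower bound. -/
theorem exists_eventually_norm_le_norm_fderiv {g : E → F} {y₀ : E} (hg : ContDiffAt ℝ 1 g y₀)
    (hinj : Function.Injective (fderiv ℝ g y₀)) :
    ∃ c : ℝ, 0 < c ∧ ∀ᶠ y in 𝓝 y₀, ∀ v, ‖v‖ ≤ c * ‖fderiv ℝ g y v‖ := by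
  obtain ⟨K, hK, hanti⟩ := (fderiv ℝ g y₀ : E →ₗ[ℝ] F).exists_antilipschitzWith
    (LinearMap.ker_eq_bot.2 hinj)
  have hK' : (0 : ℝ) < K := hK
  have hcont := hg.continuousAt_fderiv one_ne_zero
  refine ⟨2 * K, by positivity, ?_⟩
  have hev := Metric.continuousAt_iff'.1 hcont (1 / (2 * K)) (by positivity)
  filter_upwards [hev] with y hy v
  rw [dist_eq_norm] at hy
  have h1 : ‖v‖ ≤ K * ‖fderiv ℝ g y₀ v‖ := by
    simpa using hanti.le_mul_norm_sub (x := v) (y := 0)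
  have h2 : ‖fderiv ℝ g y₀ v‖ ≤ ‖fderiv ℝ g y v‖ + 1 / (2 * K) * ‖v‖ := by
    have h3 : ‖(fderiv ℝ g y - fderiv ℝ g y₀) v‖ ≤ 1 / (2 * K) * ‖v‖ :=
      ((fderiv ℝ g y - fderiv ℝ g y₀).le_opNorm v).trans (by gcongr)
    rw [sub_apply] at h3
    linarith [norm_le_norm_add_norm_sub (fderiv ℝ g y v) (fderiv ℝ g y₀ v)]
  -- The perturbation of the differential absorbs one half of the lower bound.
  have h4 : (K : ℝ) * (1 / (2 * K) * ‖v‖) = ‖v‖ / 2 := by field_simp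
  nlinarith [mul_le_mul_of_nonneg_left h2 hK'.le]

/-- Near a point, the first two derivatives of a map along straight lines are bounded in terms of
the speed for the metric induced by an immersion. -/
theorem exists_eventually_norm_fderiv_le {g : E → F} {h : E → G} {y₀ : E}
    (hg : ContDiffAt ℝ 1 g y₀) (hinj : Function.Injective (fderiv ℝ g y₀))
    (hh : ContDiffAt ℝ 2 h y₀) :
    ∃ C : ℝ, ∀ᶠ y in 𝓝 y₀, ∀ v, ‖fderiv ℝ h y v‖ ≤ C * ‖fderiv ℝ g y v‖ ∧
      ‖fderiv ℝ (fderiv ℝ h) y v v‖ ≤ C * ‖fderiv ℝ g y v‖ ^ 2 := by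
  obtain ⟨c, hc, hev⟩ := exists_eventually_norm_le_norm_fderiv hg hinj
  have h1 : ContDiffAt ℝ 1 (fderiv ℝ h) y₀ := hh.fderiv_right (by norm_num)
  have hc1 : ∀ᶠ y in 𝓝 y₀, ‖fderiv ℝ h y‖ < ‖fderiv ℝ h y₀‖ + 1 :=
    h1.continuousAt.norm.eventually_lt_const (by linarith)
  have hc2 : ∀ᶠ y in 𝓝 y₀, ‖fderiv ℝ (fderiv ℝ h) y‖ < ‖fderiv ℝ (fderiv ℝ h) y₀‖ + 1 :=
    (h1.continuousAt_fderiv one_ne_zero).norm.eventually_lt_const (by linarith)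
  set C₁ := ‖fderiv ℝ h y₀‖ + 1
  set C₂ := ‖fderiv ℝ (fderiv ℝ h) y₀‖ + 1
  have hC₁ : 0 < C₁ := by positivity
  have hC₂ : 0 < C₂ := by positivity
  refine ⟨max (C₁ * c) (C₂ * c ^ 2), ?_⟩
  filter_upwards [hev, hc1, hc2] with y hy hy1 hy2 v
  constructor
  · calc ‖fderiv ℝ h y v‖ ≤ ‖fderiv ℝ h y‖ * ‖v‖ := (fderiv ℝ h y).le_opNorm v
      _ ≤ C₁ * (c * ‖fderiv ℝ g y v‖) := by gcongr; exact hy v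
      _ = C₁ * c * ‖fderiv ℝ g y v‖ := by ring
      _ ≤ _ := by gcongr; exact le_max_left _ _
  · calc ‖fderiv ℝ (fderiv ℝ h) y v v‖ ≤ ‖fderiv ℝ (fderiv ℝ h) y‖ * ‖v‖ * ‖v‖ :=
          (fderiv ℝ (fderiv ℝ h) y).le_opNorm₂ v v
      _ ≤ C₂ * (c * ‖fderiv ℝ g y v‖) * (c * ‖fderiv ℝ g y v‖) := by gcongr <;> exact hy v
      _ = C₂ * c ^ 2 * ‖fderiv ℝ g y v‖ ^ 2 := by ring
      _ ≤ _ := by gcongr; exact le_max_right _ _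

/-- A contraction that is isometric on one tangent space of an immersion is almost isometric on
the neighbouring ones. -/
theorem eventually_mul_norm_fderiv_le {g : E → F} {y₀ : E} (hg : ContDiffAt ℝ 1 g y₀)
    (hinj : Function.Injective (fderiv ℝ g y₀)) (L : F →L[ℝ] G) (hL : ∀ w, ‖L w‖ ≤ ‖w‖)
    (hL₀ : ∀ v, ‖L (fderiv ℝ g y₀ v)‖ = ‖fderiv ℝ g y₀ v‖) {ε : ℝ} (hε : 0 < ε) :
    ∀ᶠ y in 𝓝 y₀, ∀ v, (1 - ε) * ‖fderiv ℝ g y v‖ ≤ ‖L (fderiv ℝ g y v)‖ := by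
  obtain ⟨c, hc, hev⟩ := exists_eventually_norm_le_norm_fderiv hg hinj
  have hev' := Metric.continuousAt_iff'.1 (hg.continuousAt_fderiv one_ne_zero) (ε / (2 * c))
    (by positivity)
  filter_upwards [hev, hev'] with y hy hy' v
  rw [dist_eq_norm] at hy'
  have h3 : ‖fderiv ℝ g y v - fderiv ℝ g y₀ v‖ ≤ ε / (2 * c) * ‖v‖ :=
    ((fderiv ℝ g y - fderiv ℝ g y₀).le_opNorm v).trans (by gcongr)
  have h4 : ε / (2 * c) * ‖v‖ ≤ ε / 2 * ‖fderiv ℝ g y v‖ := by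
    calc ε / (2 * c) * ‖v‖ ≤ ε / (2 * c) * (c * ‖fderiv ℝ g y v‖) := by gcongr; exact hy v
      _ = _ := by field_simp
  have h5 : ‖L (fderiv ℝ g y₀ v)‖ ≤ ‖L (fderiv ℝ g y v)‖ + ‖fderiv ℝ g y v - fderiv ℝ g y₀ v‖ := by
    have := hL (fderiv ℝ g y v - fderiv ℝ g y₀ v)
    rw [map_sub] at this
    linarith [norm_le_norm_add_norm_sub (L (fderiv ℝ g y v)) (L (fderiv ℝ g y₀ v))]
  rw [hL₀] at h5
  have h6 := norm_le_norm_add_norm_sub' (fderiv ℝ g y v) (fderiv ℝ g y₀ v)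
  linarith

end LinearAlgebra

/-! ### Second derivatives of oscillating functions -/

section CurveCalculus

variable {F G : Type*} [NormedAddCommGroup F] [NormedSpace ℝ F]
  [NormedAddCommGroup G] [NormedSpace ℝ G]

theorem deriv_continuousLinearMap_comp (ℓ : F →L[ℝ] G) {c : ℝ → F} {t : ℝ}
    (hc : DifferentiableAt ℝ c t) :
    deriv (fun s => ℓ (c s)) t = ℓ (deriv c t) :=
  (ℓ.hasFDerivAt.comp_hasDerivAt t hc.hasDerivAt).deriv

theorem deriv_deriv_continuousLinearMap_comp (ℓ : F →L[ℝ] G) {c : ℝ → F} {t : ℝ}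
    (hc : ContDiffAt ℝ 2 c t) :
    deriv (deriv fun s => ℓ (c s)) t = ℓ (deriv (deriv c) t) := by
  have h : deriv (fun s => ℓ (c s)) =ᶠ[𝓝 t] fun s => ℓ (deriv c s) := by
    filter_upwards [hc.eventually (by simp)] with s hs
    exact deriv_continuousLinearMap_comp ℓ (hs.differentiableAt (by simp))
  rw [h.deriv_eq]
  exact deriv_continuousLinearMap_comp ℓ
    ((hc.derivWithin (m := 1) (by norm_num)).differentiableAt (by simp))

theorem hasDerivAt_ofReal_mul_cexp {h θ : ℝ → ℝ} {t h' θ' : ℝ} (hh : HasDerivAt h h' t)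
    (hθ : HasDerivAt θ θ' t) :
    HasDerivAt (fun s => (h s : ℂ) * Complex.exp (θ s * Complex.I))
      ((h' + h t * θ' * Complex.I) * Complex.exp (θ t * Complex.I)) t := by
  have h1 := hh.ofReal_comp.mul ((hθ.ofReal_comp.mul_const Complex.I).cexp)
  exact h1.congr_deriv (by ring)

/-- The term `- h θ'²` is the only one that is quadratic in the frequency of the phase `θ`. -/
theorem deriv_deriv_ofReal_mul_cexp {h θ : ℝ → ℝ} {t : ℝ} (hh : ContDiffAt ℝ 2 h t)
    (hθ : ContDiffAt ℝ 2 θ t) :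
    deriv (deriv fun s => (h s : ℂ) * Complex.exp (θ s * Complex.I)) t =
      (deriv (deriv h) t - h t * deriv θ t ^ 2 +
        (2 * deriv h t * deriv θ t + h t * deriv (deriv θ) t) * Complex.I) *
          Complex.exp (θ t * Complex.I) := by
  have h1 : deriv (fun s => (h s : ℂ) * Complex.exp (θ s * Complex.I)) =ᶠ[𝓝 t]
      fun s => (deriv h s + h s * deriv θ s * Complex.I) * Complex.exp (θ s * Complex.I) := by
    filter_upwards [hh.eventually (by simp), hθ.eventually (by simp)] with s hs hs'
    exact (hasDerivAt_ofReal_mul_cexp (hs.differentiableAt (by simp)).hasDerivAt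
      (hs'.differentiableAt (by simp)).hasDerivAt).deriv
  have hd1 := (hh.differentiableAt (by simp)).hasDerivAt.ofReal_comp
  have hd2 := (hθ.differentiableAt (by simp)).hasDerivAt.ofReal_comp
  have hd3 := ((hh.derivWithin (m := 1) (by norm_num)).differentiableAt
    (by simp)).hasDerivAt.ofReal_comp
  have hd4 := ((hθ.derivWithin (m := 1) (by norm_num)).differentiableAt
    (by simp)).hasDerivAt.ofReal_comp
  refine h1.deriv_eq.trans ((((hd3.add ((hd1.mul hd4).mul_const Complex.I)).mul
    ((hd2.mul_const Complex.I).cexp)).deriv).trans ?_)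
  simp only [Pi.add_apply, Pi.mul_apply]
  linear_combination (h t : ℂ) * ((deriv θ t : ℝ) : ℂ) ^ 2 * Complex.exp (θ t * Complex.I) *
    Complex.I_sq

end CurveCalculus

/-! ### Oscillating maps -/

section OscillatingMap

variable {m : ℕ} {J K : Type*} {F : Type*} [NormedAddCommGroup F]
  [NormedSpace ℝ F]

/-- The map `x ↦ (a k * χ j x * exp (i * lam * ⟨ξ k, L j (e x)⟩))_{j, k}` with frequency `lam`,
where the phases are read off from the projections `L j ∘ e`. -/
noncomputable def oscillatingMap (a : K → ℝ) (ξ : K → EuclideanSpace ℝ (Fin m))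
    (L : J → F →L[ℝ] EuclideanSpace ℝ (Fin m)) (lam : ℝ) {X : Type*} (χ : J → X → ℝ) (e : X → F)
    (x : X) : PiLp 2 fun _ : J × K => ℂ :=
  WithLp.toLp 2 fun i => ((a i.2 * χ i.1 x : ℝ) : ℂ) *
    Complex.exp ((lam * inner ℝ (ξ i.2) (L i.1 (e x)) : ℝ) * Complex.I)

variable {a : K → ℝ} {ξ : K → EuclideanSpace ℝ (Fin m)}
  {L : J → F →L[ℝ] EuclideanSpace ℝ (Fin m)} {lam : ℝ}

theorem oscillatingMap_comp {X Y : Type*} (χ : J → X → ℝ) (e : X → F) (g : Y → X) :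
    oscillatingMap a ξ L lam χ e ∘ g = oscillatingMap a ξ L lam (fun j => χ j ∘ g) (e ∘ g) := rfl

variable [Fintype J] [Fintype K]

theorem norm_oscillatingMap (ha : ∑ k, a k ^ 2 = 1) {X : Type*} {χ : J → X → ℝ} {e : X → F} {x : X}
    (hχ : ∑ j, χ j x ^ 2 = 1) : ‖oscillatingMap a ξ L lam χ e x‖ = 1 := by
  have h : ‖oscillatingMap a ξ L lam χ e x‖ ^ 2 = 1 := by
    rw [PiLp.norm_sq_eq_of_L2, Fintype.sum_prod_type]
    simp only [oscillatingMap, norm_mul, Complex.norm_exp_ofReal_mul_I, Complex.norm_real, mul_one,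
      Real.norm_eq_abs, sq_abs, mul_pow, ← Finset.sum_mul, ha, one_mul, hχ]
  exact (pow_eq_one_iff_of_nonneg (norm_nonneg _) two_ne_zero).1 h

variable {c : ℝ → F} {χ : J → ℝ → ℝ} {t : ℝ}

theorem contDiffAt_oscillatingMap {E : Type*} [NormedAddCommGroup E] [NormedSpace ℝ E]
    {n : WithTop ℕ∞} {c : E → F} {χ : J → E → ℝ} {y : E} (hc : ContDiffAt ℝ n c y)
    (hχ : ∀ j, ContDiffAt ℝ n (χ j) y) : ContDiffAt ℝ n (oscillatingMap a ξ L lam χ c) y := by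
  rw [contDiffAt_piLp]
  intro i
  have h1 := hχ i.1
  have h2 : ContDiffAt ℝ n (fun s => lam * inner ℝ (ξ i.2) (L i.1 (c s))) y :=
    contDiffAt_const.mul (contDiffAt_const.inner ℝ ((L i.1).contDiff.contDiffAt.comp y hc))
  have h3 : ContDiffAt ℝ n (fun s => a i.2 * χ i.1 s) y := contDiffAt_const.mul h1
  exact (Complex.ofRealCLM.contDiff.contDiffAt.comp y h3).mul
    (((Complex.ofRealCLM.contDiff.contDiffAt.comp y h2).mul contDiffAt_const).cexp)

theorem deriv_phase (ξ : EuclideanSpace ℝ (Fin m)) (L : F →L[ℝ] EuclideanSpace ℝ (Fin m)) (lam : ℝ)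
    (hc : DifferentiableAt ℝ c t) :
    deriv (fun s => lam * inner ℝ ξ (L (c s))) t = lam * inner ℝ ξ (L (deriv c t)) :=
  deriv_continuousLinearMap_comp (lam • (innerSL ℝ ξ ∘L L)) hc

theorem deriv_deriv_phase (ξ : EuclideanSpace ℝ (Fin m)) (L : F →L[ℝ] EuclideanSpace ℝ (Fin m))
    (lam : ℝ) (hc : ContDiffAt ℝ 2 c t) :
    deriv (deriv fun s => lam * inner ℝ ξ (L (c s))) t =
      lam * inner ℝ ξ (L (deriv (deriv c) t)) :=
  deriv_deriv_continuousLinearMap_comp (lam • (innerSL ℝ ξ ∘L L)) hc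

theorem norm_deriv_oscillatingMap_sq (hc : ContDiffAt ℝ 2 c t) (hχ : ∀ j, ContDiffAt ℝ 2 (χ j) t) :
    ‖deriv (oscillatingMap a ξ L lam χ c) t‖ ^ 2 =
      ∑ j, ∑ k, a k ^ 2 *
        (deriv (χ j) t ^ 2 + χ j t ^ 2 * (lam * inner ℝ (ξ k) (L j (deriv c t))) ^ 2) := by
  have hd : DifferentiableAt ℝ (oscillatingMap a ξ L lam χ c) t :=
    (contDiffAt_oscillatingMap hc hχ).differentiableAt (by simp)
  rw [PiLp.norm_sq_eq_of_L2, Fintype.sum_prod_type]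
  refine Finset.sum_congr rfl fun j _ => Finset.sum_congr rfl fun k _ => ?_
  have h1 := deriv_continuousLinearMap_comp (PiLp.proj (𝕜 := ℝ) 2 (fun _ : J × K => ℂ) (j, k)) hd
  simp only [PiLp.proj_apply] at h1
  rw [← h1]
  have hd1 : HasDerivAt (fun s => a k * χ j s) (a k * deriv (χ j) t) t :=
    ((hχ j).differentiableAt (by simp)).hasDerivAt.const_mul (a k)
  have hd2 : HasDerivAt (fun s => lam * inner ℝ (ξ k) (L j (c s)))
      (lam * inner ℝ (ξ k) (L j (deriv c t))) t := by
    rw [← deriv_phase _ _ _ (hc.differentiableAt (by simp))]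
    exact ((lam • (innerSL ℝ (ξ k) ∘L L j)).differentiableAt.comp t
      (hc.differentiableAt (by simp))).hasDerivAt
  have h2 := (hasDerivAt_ofReal_mul_cexp hd1 hd2).deriv
  simp only [oscillatingMap]
  rw [h2, norm_mul, Complex.norm_exp_ofReal_mul_I, mul_one, Complex.sq_norm, Complex.normSq_apply]
  simp
  ring

/-- The leading term of the speed of a curve under the oscillating map. -/
theorem le_norm_deriv_oscillatingMap_sq (hc : ContDiffAt ℝ 2 c t)
    (hχ : ∀ j, ContDiffAt ℝ 2 (χ j) t) (ha₂ : ∀ v, ∑ k, a k ^ 2 * inner ℝ (ξ k) v ^ 2 = ‖v‖ ^ 2 / m)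
    (hχ1 : ∑ j, χ j t ^ 2 = 1) {ε : ℝ} (hε : ε ≤ 1)
    (hflat : ∀ j, χ j t ≠ 0 → (1 - ε) * ‖deriv c t‖ ≤ ‖L j (deriv c t)‖) :
    lam ^ 2 * ((1 - ε) * ‖deriv c t‖) ^ 2 / m ≤ ‖deriv (oscillatingMap a ξ L lam χ c) t‖ ^ 2 := by
  rw [norm_deriv_oscillatingMap_sq hc hχ]
  calc lam ^ 2 * ((1 - ε) * ‖deriv c t‖) ^ 2 / m
      = ∑ j, χ j t ^ 2 * (lam ^ 2 * (((1 - ε) * ‖deriv c t‖) ^ 2 / m)) := by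
        rw [← Finset.sum_mul, hχ1]; ring
    _ ≤ ∑ j, χ j t ^ 2 * (lam ^ 2 * (‖L j (deriv c t)‖ ^ 2 / m)) := by
        refine Finset.sum_le_sum fun j _ => ?_
        -- Where `χ j` vanishes, nothing is known about `L j`, but the term is zero.
        by_cases hj : χ j t = 0
        · simp [hj]
        · have h0 : 0 ≤ (1 - ε) * ‖deriv c t‖ := mul_nonneg (by linarith) (norm_nonneg _)
          have := hflat j hj
          gcongr
    _ = ∑ j, ∑ k, a k ^ 2 * (χ j t ^ 2 * (lam * inner ℝ (ξ k) (L j (deriv c t))) ^ 2) := by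
        refine Finset.sum_congr rfl fun j _ => ?_
        rw [← ha₂, Finset.mul_sum, Finset.mul_sum]
        refine Finset.sum_congr rfl fun k _ => ?_
        ring
    _ ≤ _ := by
        refine Finset.sum_le_sum fun j _ => Finset.sum_le_sum fun k _ => ?_
        gcongr
        linarith [sq_nonneg (deriv (χ j) t)]

/-- The leading term of the acceleration of a curve under the oscillating map, with an error of
lower order in the frequency. -/
theorem norm_deriv_deriv_oscillatingMap_le (hc : ContDiffAt ℝ 2 c t)
    (hχ : ∀ j, ContDiffAt ℝ 2 (χ j) t) (hξ : ∀ k, ‖ξ k‖ = 1) (ha : ∑ k, a k ^ 2 = 1)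
    (ha₄ : ∀ v, ∑ k, a k ^ 2 * inner ℝ (ξ k) v ^ 4 = 3 * ‖v‖ ^ 4 / (m * (m + 2)))
    (hL : ∀ j w, ‖L j w‖ ≤ ‖w‖) (hχ1 : ∑ j, χ j t ^ 2 = 1) {C : ℝ}
    (hc2 : ‖deriv (deriv c) t‖ ≤ C * ‖deriv c t‖ ^ 2)
    (hχ' : ∀ j, |deriv (χ j) t| ≤ C * ‖deriv c t‖)
    (hχ'' : ∀ j, |deriv (deriv (χ j)) t| ≤ C * ‖deriv c t‖ ^ 2) (hlam : 0 ≤ lam) :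
    ‖deriv (deriv (oscillatingMap a ξ L lam χ c)) t‖ ≤
      (lam ^ 2 * Real.sqrt (3 / (m * (m + 2))) + Real.sqrt (Fintype.card J) * (C * (1 + 3 * lam))) *
        ‖deriv c t‖ ^ 2 := by
  set ρ := ‖deriv c t‖ with hρ
  have hρ0 : 0 ≤ ρ := norm_nonneg _
  set θ₁ : J → K → ℝ := fun j k => lam * inner ℝ (ξ k) (L j (deriv c t)) with hθ₁
  set θ₂ : J → K → ℝ := fun j k => lam * inner ℝ (ξ k) (L j (deriv (deriv c) t)) with hθ₂
  set u : J → K → ℂ := fun j k =>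
    Complex.exp ((lam * inner ℝ (ξ k) (L j (c t)) : ℝ) * Complex.I) with hu
  have hnu : ∀ j k, ‖u j k‖ = 1 := fun j k => Complex.norm_exp_ofReal_mul_I _
  -- The acceleration is `R - A`: `A` has the terms quadratic in `lam`, and `R` the other ones.
  set A : PiLp 2 fun _ : J × K => ℂ := WithLp.toLp 2 fun i =>
    ((a i.2 * (χ i.1 t * θ₁ i.1 i.2 ^ 2) : ℝ) : ℂ) * u i.1 i.2 with hA
  set R : PiLp 2 fun _ : J × K => ℂ := WithLp.toLp 2 fun i =>
    ((a i.2 : ℝ) : ℂ) * (((deriv (deriv (χ i.1)) t : ℝ) : ℂ) +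
      ((2 * deriv (χ i.1) t * θ₁ i.1 i.2 + χ i.1 t * θ₂ i.1 i.2 : ℝ) : ℂ) * Complex.I) *
        u i.1 i.2 with hR
  have hdecomp : deriv (deriv (oscillatingMap a ξ L lam χ c)) t = R - A := by
    ext i
    have h1 := deriv_deriv_continuousLinearMap_comp (PiLp.proj (𝕜 := ℝ) 2 (fun _ : J × K => ℂ) i)
      (contDiffAt_oscillatingMap (a := a) (ξ := ξ) (L := L) (lam := lam) hc hχ)
    simp only [PiLp.proj_apply] at h1
    rw [← h1]
    have hd1 : ContDiffAt ℝ 2 (fun s => a i.2 * χ i.1 s) t := contDiffAt_const.mul (hχ i.1)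
    have hd2 : ContDiffAt ℝ 2 (fun s => lam * inner ℝ (ξ i.2) (L i.1 (c s))) t :=
      (lam • (innerSL ℝ (ξ i.2) ∘L L i.1)).contDiff.contDiffAt.comp t hc
    have h2 := deriv_deriv_ofReal_mul_cexp hd1 hd2
    have h3 : deriv (fun s => a i.2 * χ i.1 s) = fun s => a i.2 * deriv (χ i.1) s := by
      funext s; exact deriv_const_mul_field _
    simp only [oscillatingMap]
    rw [h2, deriv_phase _ _ _ (hc.differentiableAt (by simp)), deriv_deriv_phase _ _ _ hc, h3,
      deriv_const_mul_field]
    simp only [PiLp.sub_apply, hR, hA, hθ₁, hθ₂, hu]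
    push_cast
    ring
  have hA_le : ‖A‖ ≤ lam ^ 2 * Real.sqrt (3 / (m * (m + 2))) * ρ ^ 2 := by
    refine le_of_sq_le_sq ?_ (by positivity)
    rw [PiLp.norm_sq_eq_of_L2, Fintype.sum_prod_type, mul_pow, mul_pow,
      Real.sq_sqrt (by positivity)]
    calc ∑ j, ∑ k, ‖A (j, k)‖ ^ 2
        = ∑ j, χ j t ^ 2 * (lam ^ 4 * (3 * ‖L j (deriv c t)‖ ^ 4 / (m * (m + 2)))) := by
          refine Finset.sum_congr rfl fun j _ => ?_
          rw [← ha₄, Finset.mul_sum, Finset.mul_sum]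
          refine Finset.sum_congr rfl fun k _ => ?_
          simp only [hA, norm_mul, hnu, Complex.norm_real, mul_one, Real.norm_eq_abs, mul_pow,
            sq_abs, hθ₁, abs_pow]
          ring
      _ ≤ ∑ j, χ j t ^ 2 * (lam ^ 4 * (3 * ρ ^ 4 / (m * (m + 2)))) := by
          gcongr with j
          exact hL j _
      _ = (lam ^ 2) ^ 2 * (3 / (m * (m + 2))) * (ρ ^ 2) ^ 2 := by
          rw [← Finset.sum_mul, hχ1]; ring
  have hχle : ∀ j, |χ j t| ≤ 1 := by
    intro j
    rw [abs_le_one_iff_mul_self_le_one, ← sq, ← hχ1]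
    exact Finset.single_le_sum (f := fun j => χ j t ^ 2) (fun j _ => sq_nonneg _)
      (Finset.mem_univ j)
  have hinner : ∀ j k w, |inner ℝ (ξ k) (L j w)| ≤ ‖w‖ := by
    intro j k w
    calc |inner ℝ (ξ k) (L j w)| ≤ ‖ξ k‖ * ‖L j w‖ := abs_real_inner_le_norm _ _
      _ ≤ ‖w‖ := by rw [hξ, one_mul]; exact hL j w
  have hR_le : ‖R‖ ≤ Real.sqrt (Fintype.card J) * (C * (1 + 3 * lam)) * ρ ^ 2 := by
    by_cases hJ : IsEmpty J
    · simp at hχ1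
    rw [not_isEmpty_iff] at hJ
    obtain ⟨j₀⟩ := hJ
    have hCρ : 0 ≤ C * ρ := (abs_nonneg _).trans (hχ' j₀)
    have hCρ2 : 0 ≤ C * ρ ^ 2 := (abs_nonneg _).trans (hχ'' j₀)
    have hnn : 0 ≤ Real.sqrt (Fintype.card J) * (C * (1 + 3 * lam)) * ρ ^ 2 := by
      have : 0 ≤ (1 + 3 * lam) * (C * ρ ^ 2) := by positivity
      calc (0 : ℝ) ≤ Real.sqrt (Fintype.card J) * ((1 + 3 * lam) * (C * ρ ^ 2)) := by positivity
        _ = _ := by ring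
    refine le_of_sq_le_sq ?_ hnn
    rw [PiLp.norm_sq_eq_of_L2, Fintype.sum_prod_type]
    have hterm : ∀ j k, ‖R (j, k)‖ ^ 2 ≤ a k ^ 2 * (C * (1 + 3 * lam) * ρ ^ 2) ^ 2 := by
      intro j k
      have hθ1 : |θ₁ j k| ≤ lam * ρ := by
        rw [hθ₁, abs_mul, abs_of_nonneg hlam]
        exact mul_le_mul_of_nonneg_left (hinner _ _ _) hlam
      have hθ2 : |θ₂ j k| ≤ lam * (C * ρ ^ 2) := by
        rw [hθ₂, abs_mul, abs_of_nonneg hlam]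
        exact mul_le_mul_of_nonneg_left ((hinner _ _ _).trans hc2) hlam
      have hbr : ‖((deriv (deriv (χ j)) t : ℝ) : ℂ) +
          ((2 * deriv (χ j) t * θ₁ j k + χ j t * θ₂ j k : ℝ) : ℂ) * Complex.I‖ ≤
          C * (1 + 3 * lam) * ρ ^ 2 := by
        refine (norm_add_le _ _).trans ?_
        rw [norm_mul, Complex.norm_I, mul_one, Complex.norm_real, Complex.norm_real,
          Real.norm_eq_abs, Real.norm_eq_abs]
        have h1 : |2 * deriv (χ j) t * θ₁ j k + χ j t * θ₂ j k| ≤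
            2 * (C * ρ) * (lam * ρ) + 1 * (lam * (C * ρ ^ 2)) := by
          refine (abs_add_le _ _).trans ?_
          rw [abs_mul (2 * deriv (χ j) t) (θ₁ j k), abs_mul 2, abs_mul (χ j t), abs_two]
          exact add_le_add
            (mul_le_mul (mul_le_mul_of_nonneg_left (hχ' j) zero_le_two) hθ1 (abs_nonneg _)
              (mul_nonneg zero_le_two hCρ))
            (mul_le_mul (hχle j) hθ2 (abs_nonneg _) zero_le_one)
        calc _ ≤ C * ρ ^ 2 + (2 * (C * ρ) * (lam * ρ) + 1 * (lam * (C * ρ ^ 2))) :=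
              add_le_add (hχ'' j) h1
          _ = _ := by ring
      have hRn : ‖R (j, k)‖ = |a k| * ‖((deriv (deriv (χ j)) t : ℝ) : ℂ) +
          ((2 * deriv (χ j) t * θ₁ j k + χ j t * θ₂ j k : ℝ) : ℂ) * Complex.I‖ := by
        simp only [hR]
        rw [norm_mul, norm_mul, hnu, mul_one, Complex.norm_real, Real.norm_eq_abs]
      rw [hRn, mul_pow, sq_abs]
      exact mul_le_mul_of_nonneg_left (pow_le_pow_left₀ (norm_nonneg _) hbr 2) (sq_nonneg _)
    calc ∑ j, ∑ k, ‖R (j, k)‖ ^ 2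
        ≤ ∑ _j : J, ∑ k, a k ^ 2 * (C * (1 + 3 * lam) * ρ ^ 2) ^ 2 :=
          Finset.sum_le_sum fun j _ => Finset.sum_le_sum fun k _ => hterm j k
      _ = (Real.sqrt (Fintype.card J)) ^ 2 * (C * (1 + 3 * lam) * ρ ^ 2) ^ 2 := by
          rw [← Finset.sum_mul, ha, Real.sq_sqrt (by positivity)]
          simp
      _ = _ := by ring
  rw [hdecomp]
  calc ‖R - A‖ ≤ ‖R‖ + ‖A‖ := norm_sub_le _ _
    _ ≤ _ := add_le_add hR_le hA_le
    _ = _ := by ring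

end OscillatingMap

/-! ### Monotonicity in the dimension of the ambient space -/

section Monotonicity

variable {m N N' : ℕ} {X : Type*} [TopologicalSpace X] [ChartedSpace (EuclideanSpace ℝ (Fin m)) X]
  {E E' E'' : Type*} [NormedAddCommGroup E] [NormedSpace ℝ E] [NormedAddCommGroup E']
  [InnerProductSpace ℝ E'] [NormedAddCommGroup E''] [InnerProductSpace ℝ E'']

theorem injective_mfderiv_linearIsometry_comp (L : E' →ₗᵢ[ℝ] E'') {f : X → E'}
    (hf : ContMDiff (𝓡 m) 𝓘(ℝ, E') ∞ f) {x : X}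
    (hx : Function.Injective (mfderiv (𝓡 m) 𝓘(ℝ, E') f x)) :
    Function.Injective (mfderiv (𝓡 m) 𝓘(ℝ, E'') (L ∘ f) x) := by
  have h : mfderiv (𝓡 m) 𝓘(ℝ, E'') (L.toContinuousLinearMap ∘ f) x =
      L.toContinuousLinearMap ∘L mfderiv (𝓡 m) 𝓘(ℝ, E') f x := by
    rw [mfderiv_comp x L.toContinuousLinearMap.mdifferentiableAt
      (hf.mdifferentiableAt (by simp)), ContinuousLinearMap.mfderiv_eq]
    rfl
  exact h ▸ L.injective.comp hx

variable [CompleteSpace E'] [CompleteSpace E'']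

/-- Differentiability is not needed: a linear isometry has a continuous linear left inverse. -/
theorem LinearIsometry.fderiv_comp_eq (L : E' →ₗᵢ[ℝ] E'') (g : E → E') (y : E) :
    fderiv ℝ (L ∘ g) y = L.toContinuousLinearMap ∘L fderiv ℝ g y := by
  by_cases hg : DifferentiableAt ℝ g y
  · exact (L.toContinuousLinearMap.hasFDerivAt.comp y hg.hasFDerivAt).fderiv
  · have hLg : ¬ DifferentiableAt ℝ (L ∘ g) y := by
      intro h
      apply hg
      set P := ContinuousLinearMap.adjoint L.toContinuousLinearMap with hP
      have hPL : P ∘L L.toContinuousLinearMap = 1 :=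
        (L.toContinuousLinearMap.norm_map_iff_adjoint_comp_self).1 L.norm_map
      have h1 : g = P ∘ (L ∘ g) := by
        funext z
        exact (congrArg (fun T : E' →L[ℝ] E' => T (g z)) hPL).symm
      rw [h1]
      exact P.differentiableAt.comp y h
    rw [fderiv_zero_of_not_differentiableAt hg, fderiv_zero_of_not_differentiableAt hLg]
    ext; simp

theorem LinearIsometry.deriv_comp_eq (L : E' →ₗᵢ[ℝ] E'') (g : ℝ → E') :
    deriv (L ∘ g) = L ∘ deriv g := by
  funext t
  change fderiv ℝ (L ∘ g) t 1 = L (fderiv ℝ g t 1)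
  rw [L.fderiv_comp_eq]
  rfl

theorem inducedMetric_linearIsometry_comp
    (L : EuclideanSpace ℝ (Fin N) →ₗᵢ[ℝ] EuclideanSpace ℝ (Fin N'))
    (f : X → EuclideanSpace ℝ (Fin N)) :
    inducedMetric (m := m) (L ∘ f) = inducedMetric (m := m) f := by
  funext p y v w
  simp only [inducedMetric, Function.comp_assoc, L.fderiv_comp_eq]
  exact L.inner_map_map _ _

theorem curvPerp_linearIsometry_comp
    (L : EuclideanSpace ℝ (Fin N) →ₗᵢ[ℝ] EuclideanSpace ℝ (Fin N'))
    (f : X → EuclideanSpace ℝ (Fin N)) :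
    curvPerp (m := m) (L ∘ f) = curvPerp (m := m) f := by
  have h1 : ∀ γ a b, IsUnitSpeedGeodesic (m := m) (L ∘ f) γ a b ↔
      IsUnitSpeedGeodesic (m := m) f γ a b := by
    intro γ a b
    constructor
    · rintro ⟨h1, h2, h3⟩
      rw [inducedMetric_linearIsometry_comp] at h2 h3
      exact ⟨h1, h2, h3⟩
    · rintro ⟨h1, h2, h3⟩
      refine ⟨h1, ?_, ?_⟩ <;> rw [inducedMetric_linearIsometry_comp]
      · exact h2
      · exact h3
  simp only [curvPerp, h1, Function.comp_assoc, L.deriv_comp_eq, Function.comp_apply,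
    LinearIsometry.norm_map]

theorem IsSmoothImmersion.linearIsometry_comp
    (L : EuclideanSpace ℝ (Fin N) →ₗᵢ[ℝ] EuclideanSpace ℝ (Fin N'))
    {f : X → EuclideanSpace ℝ (Fin N)} (hf : IsSmoothImmersion (m := m) f) :
    IsSmoothImmersion (m := m) (L ∘ f) :=
  ⟨L.toContinuousLinearMap.contMDiff.comp hf.contMDiff,
    fun x => injective_mfderiv_linearIsometry_comp L hf.contMDiff (hf.injective_mfderiv x)⟩

/-- More room makes the minimal curvature smaller. -/
theorem minCurvPerp_antitone (m : ℕ) (X : Type*) [TopologicalSpace X]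
    [ChartedSpace (EuclideanSpace ℝ (Fin m)) X] : Antitone (minCurvPerp m X) := by
  refine antitone_nat_of_succ_le fun N => ?_
  let L : EuclideanSpace ℝ (Fin N) →ₗᵢ[ℝ] EuclideanSpace ℝ (Fin (N + 1)) :=
    { toFun := fun x => WithLp.toLp 2 (Fin.cons 0 fun i => x i)
      map_add' := fun x y => by
        ext i; refine Fin.cases ?_ (fun i => ?_) i <;> simp
      map_smul' := fun c x => by
        ext i; refine Fin.cases ?_ (fun i => ?_) i <;> simp
      norm_map' := fun x => by
        simp [EuclideanSpace.norm_eq, Fin.sum_univ_succ] }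
  refine le_iInf fun f => le_iInf fun hf => le_iInf fun hball => ?_
  refine iInf_le_of_le (L ∘ f) (iInf_le_of_le (hf.linearIsometry_comp L)
    (iInf_le_of_le (fun x => ?_) (curvPerp_linearIsometry_comp L f).le))
  simpa using hball x

end Monotonicity

/-! ### Straight lines in charts -/

section ChartLines

variable {m : ℕ} {X : Type*} [TopologicalSpace X] [ChartedSpace (EuclideanSpace ℝ (Fin m)) X]
  {F : Type*} [NormedAddCommGroup F] [NormedSpace ℝ F]

/-- The curve through `x` that is a straight line with velocity `v` in the preferred chart at `p`;
meaningful for `x` in the domain of this chart and for small times. -/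
noncomputable def chartLine (p x : X) (v : EuclideanSpace ℝ (Fin m)) (s : ℝ) : X :=
  (chartAt (EuclideanSpace ℝ (Fin m)) p).symm (chartAt (EuclideanSpace ℝ (Fin m)) p x + s • v)

theorem chartLine_zero {p x : X} (hx : x ∈ (chartAt (EuclideanSpace ℝ (Fin m)) p).source)
    (v : EuclideanSpace ℝ (Fin m)) : chartLine p x v 0 = x := by
  simp [chartLine, (chartAt (EuclideanSpace ℝ (Fin m)) p).left_inv hx]

theorem mfderiv_eq_fderiv_comp_chartAt_symm {h : X → F}
    (hh : ContMDiff (𝓡 m) 𝓘(ℝ, F) ∞ h) (x : X) : mfderiv (𝓡 m) 𝓘(ℝ, F) h x =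
    fderiv ℝ (h ∘ (chartAt (EuclideanSpace ℝ (Fin m)) x).symm)
      (chartAt (EuclideanSpace ℝ (Fin m)) x x) := by
  refine (hh.mdifferentiableAt (by simp)).mfderiv.trans ?_
  simp [writtenInExtChartAt, fderivWithin_univ]
  rfl

variable [IsManifold (𝓡 m) ∞ X] {h : X → F} (hh : ContMDiff (𝓡 m) 𝓘(ℝ, F) ∞ h) {p x : X}
  (hx : x ∈ (chartAt (EuclideanSpace ℝ (Fin m)) p).source) (v : EuclideanSpace ℝ (Fin m))

include hh hx in
theorem contDiffAt_comp_chartLine : ContDiffAt ℝ 2 (h ∘ chartLine p x v) 0 := by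
  have h1 : ContDiffAt ℝ 2 (h ∘ (chartAt (EuclideanSpace ℝ (Fin m)) p).symm)
      (chartAt (EuclideanSpace ℝ (Fin m)) p x + (0 : ℝ) • v) := by
    rw [zero_smul, add_zero]
    exact (contDiffAt_comp_chartAt_symm hh
      ((chartAt (EuclideanSpace ℝ (Fin m)) p).map_source hx)).of_le ENat.LEInfty.out
  have h2 : ContDiffAt ℝ 2
      (fun s : ℝ => chartAt (EuclideanSpace ℝ (Fin m)) p x + s • v) 0 := by fun_prop
  exact ContDiffAt.comp (g := h ∘ (chartAt (EuclideanSpace ℝ (Fin m)) p).symm) (0 : ℝ) h1 h2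

include hh hx in
theorem deriv_comp_chartLine : deriv (h ∘ chartLine p x v) 0 =
    fderiv ℝ (h ∘ (chartAt (EuclideanSpace ℝ (Fin m)) p).symm)
      (chartAt (EuclideanSpace ℝ (Fin m)) p x) v :=
  deriv_comp_line v ((contDiffAt_comp_chartAt_symm hh
    ((chartAt (EuclideanSpace ℝ (Fin m)) p).map_source hx)).differentiableAt (by simp))

include hh hx in
theorem deriv_deriv_comp_chartLine : deriv (deriv (h ∘ chartLine p x v)) 0 =
    fderiv ℝ (fderiv ℝ (h ∘ (chartAt (EuclideanSpace ℝ (Fin m)) p).symm))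
      (chartAt (EuclideanSpace ℝ (Fin m)) p x) v v :=
  deriv_deriv_comp_line v ((contDiffAt_comp_chartAt_symm hh
    ((chartAt (EuclideanSpace ℝ (Fin m)) p).map_source hx)).of_le ENat.LEInfty.out)

end ChartLines

/-! ### Uniform bounds on compact manifolds -/

section Immersions

variable {m : ℕ} {X : Type*} [TopologicalSpace X] [ChartedSpace (EuclideanSpace ℝ (Fin m)) X]
  [IsManifold (𝓡 m) ∞ X] {F G : Type*} [NormedAddCommGroup F] [NormedSpace ℝ F]
  [NormedAddCommGroup G] [NormedSpace ℝ G] {e : X → F}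
  (he : ContMDiff (𝓡 m) 𝓘(ℝ, F) ∞ e)
  (hinj : ∀ x, Function.Injective (mfderiv (𝓡 m) 𝓘(ℝ, F) e x))

include he hinj in
/-- On a compact manifold, the charts used to compare with straight lines can be chosen from a
finite set, so that all bounds are uniform. -/
theorem exists_uniform_bound_chartLine [CompactSpace X] {h : X → G}
    (hh : ContMDiff (𝓡 m) 𝓘(ℝ, G) ∞ h) :
    ∃ C : ℝ, 0 ≤ C ∧ ∀ x, ∃ p, x ∈ (chartAt (EuclideanSpace ℝ (Fin m)) p).source ∧
      ∀ v : EuclideanSpace ℝ (Fin m),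
      ‖deriv (h ∘ chartLine p x v) 0‖ ≤ C * ‖deriv (e ∘ chartLine p x v) 0‖ ∧
      ‖deriv (deriv (h ∘ chartLine p x v)) 0‖ ≤ C * ‖deriv (e ∘ chartLine p x v) 0‖ ^ 2 := by
  have hloc : ∀ p : X, ∃ C : ℝ, ∀ᶠ x in 𝓝 p,
      x ∈ (chartAt (EuclideanSpace ℝ (Fin m)) p).source ∧
      ∀ v : EuclideanSpace ℝ (Fin m),
      ‖deriv (h ∘ chartLine p x v) 0‖ ≤ C * ‖deriv (e ∘ chartLine p x v) 0‖ ∧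
      ‖deriv (deriv (h ∘ chartLine p x v)) 0‖ ≤ C * ‖deriv (e ∘ chartLine p x v) 0‖ ^ 2 := by
    intro p
    have hp := mem_chart_source (EuclideanSpace ℝ (Fin m)) p
    have hpt := (chartAt (EuclideanSpace ℝ (Fin m)) p).map_source hp
    have hi := hinj p
    rw [mfderiv_eq_fderiv_comp_chartAt_symm he] at hi
    obtain ⟨C, hC⟩ := exists_eventually_norm_fderiv_le
      ((contDiffAt_comp_chartAt_symm he hpt).of_le ENat.LEInfty.out) hi
      ((contDiffAt_comp_chartAt_symm hh hpt).of_le ENat.LEInfty.out)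
    refine ⟨C, ?_⟩
    have hsrc := (chartAt (EuclideanSpace ℝ (Fin m)) p).open_source.mem_nhds hp
    filter_upwards [hsrc, ((chartAt (EuclideanSpace ℝ (Fin m)) p).continuousAt hp).eventually hC]
      with x hx hxC
    refine ⟨hx, fun v => ?_⟩
    rw [deriv_comp_chartLine hh hx, deriv_comp_chartLine he hx, deriv_deriv_comp_chartLine hh hx]
    exact hxC v
  choose C hC using hloc
  obtain ⟨t, ht⟩ := CompactSpace.elim_nhds_subcover _ hC
  refine ⟨∑ p ∈ t, |C p|, Finset.sum_nonneg fun _ _ => abs_nonneg _, fun x => ?_⟩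
  obtain ⟨p, hp, hxp, hxC⟩ : ∃ p ∈ t, x ∈ {x | x ∈ (chartAt (EuclideanSpace ℝ (Fin m)) p).source ∧
      ∀ v : EuclideanSpace ℝ (Fin m),
      ‖deriv (h ∘ chartLine p x v) 0‖ ≤ C p * ‖deriv (e ∘ chartLine p x v) 0‖ ∧
      ‖deriv (deriv (h ∘ chartLine p x v)) 0‖ ≤
        C p * ‖deriv (e ∘ chartLine p x v) 0‖ ^ 2} := by
    have : x ∈ (⊤ : Set X) := mem_univ x
    rw [← ht] at this
    simpa only [mem_iUnion, exists_prop] using this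
  have hle : C p ≤ ∑ p ∈ t, |C p| :=
    (le_abs_self _).trans (Finset.single_le_sum (f := fun p => |C p|) (fun _ _ => abs_nonneg _) hp)
  exact ⟨p, hxp, fun v => ⟨(hxC v).1.trans (by gcongr), (hxC v).2.trans (by gcongr)⟩⟩

end Immersions

/-! ### Nearly flat pieces and partitions of unity -/

section Flatness

variable {m : ℕ} {X : Type*} [TopologicalSpace X] [ChartedSpace (EuclideanSpace ℝ (Fin m)) X]
  [IsManifold (𝓡 m) ∞ X] {F : Type*} [NormedAddCommGroup F] [InnerProductSpace ℝ F]

/-- Near every point, an immersed manifold is projected almost isometrically to its tangent space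
at that point. -/
theorem exists_contraction_almost_isometric {e : X → F} (he : ContMDiff (𝓡 m) 𝓘(ℝ, F) ∞ e)
    (hinj : ∀ x, Function.Injective (mfderiv (𝓡 m) 𝓘(ℝ, F) e x)) {ε : ℝ} (hε : 0 < ε) (p : X) :
    ∃ L : F →L[ℝ] EuclideanSpace ℝ (Fin m), (∀ w, ‖L w‖ ≤ ‖w‖) ∧ ∀ᶠ x in 𝓝 p,
      ∀ q, x ∈ (chartAt (EuclideanSpace ℝ (Fin m)) q).source →
        ∀ v : EuclideanSpace ℝ (Fin m),
        (1 - ε) * ‖deriv (e ∘ chartLine q x v) 0‖ ≤ ‖L (deriv (e ∘ chartLine q x v) 0)‖ := by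
  have hp := mem_chart_source (EuclideanSpace ℝ (Fin m)) p
  have hi : Function.Injective (fderiv ℝ (e ∘ (chartAt (EuclideanSpace ℝ (Fin m)) p).symm)
      (chartAt (EuclideanSpace ℝ (Fin m)) p p)) := by
    rw [← mfderiv_eq_fderiv_comp_chartAt_symm he]
    exact hinj p
  obtain ⟨L, hL, hL₀⟩ := exists_contraction_isometric_on_range _ hi
  refine ⟨L, hL, ?_⟩
  have hev := eventually_mul_norm_fderiv_le ((contDiffAt_comp_chartAt_symm he
    ((chartAt (EuclideanSpace ℝ (Fin m)) p).map_source hp)).of_le ENat.LEInfty.out) hi L hL hL₀ hε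
  filter_upwards [(chartAt (EuclideanSpace ℝ (Fin m)) p).open_source.mem_nhds hp,
    ((chartAt (EuclideanSpace ℝ (Fin m)) p).continuousAt hp).eventually hev] with x hx hxL q hq v
  rw [deriv_comp_chartLine he hq, fderiv_comp_chartAt_symm_eq he hq hx]
  exact hxL _

/-- A smooth partition of unity by squares, with finitely many functions, subordinate to a cover of
a compact manifold by neighbourhoods. -/
theorem exists_sq_partition_of_unity [T2Space X] [CompactSpace X] (U : X → Set X)
    (hU : ∀ p, U p ∈ 𝓝 p) :
    ∃ (t : Finset X) (χ : t → X → ℝ), (∀ j, ContMDiff (𝓡 m) 𝓘(ℝ, ℝ) ∞ (χ j)) ∧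
      (∀ x, ∑ j, χ j x ^ 2 = 1) ∧ ∀ j x, χ j x ≠ 0 → x ∈ U j := by
  obtain ⟨t, ht⟩ := CompactSpace.elim_nhds_subcover (fun p => interior (U p))
    fun p => interior_mem_nhds.2 (hU p)
  obtain ⟨ρ, hρ⟩ := SmoothPartitionOfUnity.exists_isSubordinate (𝓡 m) (isClosed_univ (X := X))
    (fun j : t => interior (U j)) (fun _ => isOpen_interior) (by
      intro x _
      have : x ∈ (⊤ : Set X) := mem_univ x
      rw [← ht] at this
      simpa using this)
  have hS : ∀ x, 0 < ∑ j, ρ j x ^ 2 := by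
    intro x
    obtain ⟨j, hj⟩ := ρ.exists_pos_of_mem (mem_univ x)
    exact Finset.sum_pos' (fun _ _ => sq_nonneg _) ⟨j, Finset.mem_univ j, by positivity⟩
  have hSd : ContMDiff (𝓡 m) 𝓘(ℝ, ℝ) ∞ fun x => (Real.sqrt (∑ j, ρ j x ^ 2))⁻¹ := by
    have h1 : ContMDiff (𝓡 m) 𝓘(ℝ, ℝ) ∞ fun x => ∑ j, ρ j x ^ 2 :=
      contMDiff_finsetSum fun j _ => (ρ j).contMDiff.pow 2
    intro x
    have h2 : ContDiffAt ℝ ∞ (fun r : ℝ => (Real.sqrt r)⁻¹) (∑ j, ρ j x ^ 2) :=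
      (Real.contDiffAt_sqrt (hS x).ne').inv (Real.sqrt_pos.2 (hS x)).ne'
    exact ContMDiffAt.comp (g := fun r : ℝ => (Real.sqrt r)⁻¹) x h2.contMDiffAt (h1 x)
  refine ⟨t, fun j x => ρ j x * (Real.sqrt (∑ j, ρ j x ^ 2))⁻¹,
    fun j => (ρ j).contMDiff.mul hSd, fun x => ?_, fun j x hx => ?_⟩
  · simp only [mul_pow, ← Finset.sum_mul, inv_pow, Real.sq_sqrt (hS x).le]
    exact mul_inv_cancel₀ (hS x).ne'
  · exact interior_subset (hρ j (subset_tsupport _ (left_ne_zero_of_mul hx)))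

end Flatness

/-! ### Immersions with small curvature -/

section Construction

universe u

variable {m : ℕ} {X : Type u} [TopologicalSpace X] [T2Space X] [CompactSpace X]
  [ChartedSpace (EuclideanSpace ℝ (Fin m)) X] [IsManifold (𝓡 m) ∞ X]

/-- There are immersions in the unit sphere for which straight lines in suitable charts have an
acceleration arbitrarily close to `√(3m/(m+2))`, the curvature of the maps of `ℝ^m` given by a
spherical 4-design. -/
theorem exists_immersion_norm_deriv_deriv_le (hm : 0 < m) {δ : ℝ} (hδ : 0 < δ) :
    ∃ (I : Type u) (_ : Fintype I) (Z : X → PiLp 2 fun _ : I => ℂ),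
      ContMDiff (𝓡 m) 𝓘(ℝ, PiLp 2 fun _ : I => ℂ) ∞ Z ∧
      (∀ x, Function.Injective (mfderiv (𝓡 m) 𝓘(ℝ, PiLp 2 fun _ : I => ℂ) Z x)) ∧
      (∀ x, ‖Z x‖ = 1) ∧
      ∀ x, ∃ p, x ∈ (chartAt (EuclideanSpace ℝ (Fin m)) p).source ∧
        ∀ v : EuclideanSpace ℝ (Fin m), ‖deriv (Z ∘ chartLine p x v) 0‖ = 1 →
          ‖deriv (deriv (Z ∘ chartLine p x v)) 0‖ ≤
            Real.sqrt (3 * (m : ℝ) / ((m : ℝ) + 2)) + δ := by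
  have hm' : (0 : ℝ) < m := by exact_mod_cast hm
  obtain ⟨q, e, he, -, hinj⟩ := exists_embedding_euclidean_of_compact (I := 𝓡 m) (M := X)
  obtain ⟨K, _, a, ξ, hξ, ha, ha₂, ha₄⟩ := exists_spherical_design hm
  set S := Real.sqrt (3 * (m : ℝ) / ((m : ℝ) + 2)) with hS
  have hmS : Real.sqrt (3 / (m * (m + 2))) * m = S := by
    rw [hS, ← Real.sqrt_sq hm'.le, ← Real.sqrt_mul (by positivity), Real.sqrt_sq hm'.le]
    congr 1
    field_simp
  -- The loss of `ε` in the projections to the tangent spaces costs less than `δ / 2`.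
  obtain ⟨ε, hε0, hε1, hεS⟩ : ∃ ε : ℝ, 0 < ε ∧ ε < 1 ∧ S / (1 - ε) ^ 2 < S + δ / 2 := by
    have hcont : ContinuousAt (fun ε : ℝ => S / (1 - ε) ^ 2) 0 :=
      ContinuousAt.div (by fun_prop) (by fun_prop) (by norm_num)
    have h1 : ∀ᶠ ε : ℝ in 𝓝 0, S / (1 - ε) ^ 2 < S + δ / 2 :=
      hcont.eventually_lt_const (by simpa using hδ)
    have h2 := (h1.and (eventually_lt_nhds (zero_lt_one' ℝ))).filter_mono
      (nhdsWithin_le_nhds (s := Ioi 0))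
    obtain ⟨ε, ⟨h3, h4⟩, h5⟩ := (h2.and self_mem_nhdsWithin).exists
    exact ⟨ε, h5, h4, h3⟩
  -- `L p` is the projection to the tangent space at `p`, and `χ j` is supported where `L j` is
  -- almost isometric.
  choose L hL hflat using exists_contraction_almost_isometric he hinj hε0
  obtain ⟨J, χ, hχ, hχ1, hχU⟩ := exists_sq_partition_of_unity (m := m) _ hflat
  -- The embedding and the cut-off functions together, to bound their derivatives in common charts.
  set H : X → EuclideanSpace ℝ (Fin q) × (J → ℝ) := fun x => (e x, fun j => χ j x) with hH
  have hHs : ContMDiff (𝓡 m) 𝓘(ℝ, EuclideanSpace ℝ (Fin q) × (J → ℝ)) ∞ H :=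
    he.prodMk_space (contMDiff_pi_space.2 hχ)
  obtain ⟨C, hC0, hC⟩ := exists_uniform_bound_chartLine he hinj hHs
  -- The frequency makes the lower order terms cost less than `δ / 2`.
  set Q := 4 * (Real.sqrt (Fintype.card J) * C) * m / (1 - ε) ^ 2 with hQ
  have h1ε : 0 < 1 - ε := by linarith
  have hQ0 : 0 ≤ Q := by positivity
  obtain ⟨lam, hlam1, hlamQ⟩ : ∃ lam : ℝ, 1 ≤ lam ∧ Q / lam ≤ δ / 2 := by
    refine ⟨max 1 (2 * Q / δ), le_max_left _ _, ?_⟩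
    rw [div_le_iff₀ (by positivity)]
    calc Q = δ / 2 * (2 * Q / δ) := by field_simp
      _ ≤ _ := by gcongr; exact le_max_right _ _
  have hlam0 : 0 < lam := by linarith
  let Z : X → PiLp 2 fun _ : J × K => ℂ := oscillatingMap a ξ (fun j : J => L j) lam χ e
  have hZs : ContMDiff (𝓡 m) 𝓘(ℝ, PiLp 2 fun _ : J × K => ℂ) ∞ Z := by
    intro x
    have h1 : ContDiffAt ℝ ∞ (oscillatingMap a ξ (fun j : J => L j) lam
        (fun j (w : EuclideanSpace ℝ (Fin q) × (J → ℝ)) => w.2 j) Prod.fst) (H x) :=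
      contDiffAt_oscillatingMap contDiffAt_fst fun j => by fun_prop
    exact h1.contMDiffAt.comp x (hHs x)
  have hline_e : ∀ {p x : X}, x ∈ (chartAt (EuclideanSpace ℝ (Fin m)) p).source →
      ∀ v : EuclideanSpace ℝ (Fin m), ContDiffAt ℝ 2 (e ∘ chartLine p x v) 0 :=
    fun hx v => contDiffAt_comp_chartLine he hx v
  have hline_χ : ∀ {p x : X}, x ∈ (chartAt (EuclideanSpace ℝ (Fin m)) p).source →
      ∀ (v : EuclideanSpace ℝ (Fin m)) j, ContDiffAt ℝ 2 (χ j ∘ chartLine p x v) 0 :=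
    fun hx v j => contDiffAt_comp_chartLine (hχ j) hx v
  have hline_sum : ∀ {p x : X}, x ∈ (chartAt (EuclideanSpace ℝ (Fin m)) p).source →
      ∀ v : EuclideanSpace ℝ (Fin m), ∑ j, (χ j ∘ chartLine p x v) 0 ^ 2 = 1 := fun _ v => hχ1 _
  have hlower : ∀ {p x : X}, x ∈ (chartAt (EuclideanSpace ℝ (Fin m)) p).source →
      ∀ v : EuclideanSpace ℝ (Fin m),
      lam ^ 2 * ((1 - ε) * ‖deriv (e ∘ chartLine p x v) 0‖) ^ 2 / m ≤
        ‖deriv (Z ∘ chartLine p x v) 0‖ ^ 2 := by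
    intro p x hx v
    rw [oscillatingMap_comp]
    refine le_norm_deriv_oscillatingMap_sq (hline_e hx v) (hline_χ hx v) ha₂ (hline_sum hx v)
      hε1.le fun j hj => ?_
    rw [Function.comp_apply, chartLine_zero hx] at hj
    exact hχU j x hj p hx v
  refine ⟨J × K, inferInstance, Z, hZs, fun x => ?_, fun x => norm_oscillatingMap ha (hχ1 x),
    fun x => ?_⟩
  · have hx := mem_chart_source (EuclideanSpace ℝ (Fin m)) x
    have hinj' : Function.Injective (fderiv ℝ (Z ∘ (chartAt (EuclideanSpace ℝ (Fin m)) x).symm)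
        (chartAt (EuclideanSpace ℝ (Fin m)) x x)) := by
      rw [injective_iff_map_eq_zero]
      intro v hv
      rw [← deriv_comp_chartLine hZs hx, ← norm_eq_zero] at hv
      have h1 := hlower hx v
      rw [hv] at h1
      have h2 : ‖deriv (e ∘ chartLine x x v) 0‖ = 0 := by
        by_contra h
        have : 0 < ‖deriv (e ∘ chartLine x x v) 0‖ := lt_of_le_of_ne (norm_nonneg _) (Ne.symm h)
        have : 0 < lam ^ 2 * ((1 - ε) * ‖deriv (e ∘ chartLine x x v) 0‖) ^ 2 / m := by positivity
        linarith
      rw [norm_eq_zero, deriv_comp_chartLine he hx] at h2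
      have h3 : Function.Injective (fderiv ℝ (e ∘ (chartAt (EuclideanSpace ℝ (Fin m)) x).symm)
          (chartAt (EuclideanSpace ℝ (Fin m)) x x)) := by
        rw [← mfderiv_eq_fderiv_comp_chartAt_symm he]
        exact hinj x
      exact h3 (h2.trans (map_zero _).symm)
    rw [mfderiv_eq_fderiv_comp_chartAt_symm hZs]
    exact hinj'
  · obtain ⟨p, hp, hpC⟩ := hC x
    refine ⟨p, hp, fun v hv1 => ?_⟩
    have hlow := hlower hp v
    rw [hv1] at hlow
    have hH1 := contDiffAt_comp_chartLine hHs hp v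
    have hχline : ∀ j, χ j ∘ chartLine p x v =
        fun s => (ContinuousLinearMap.proj (R := ℝ) (φ := fun _ : J => ℝ) j ∘L
          ContinuousLinearMap.snd ℝ (EuclideanSpace ℝ (Fin q)) (J → ℝ))
            ((H ∘ chartLine p x v) s) := fun j => rfl
    have heline : e ∘ chartLine p x v =
        fun s => ContinuousLinearMap.fst ℝ (EuclideanSpace ℝ (Fin q)) (J → ℝ)
          ((H ∘ chartLine p x v) s) := rfl
    have hproj : ∀ (j : J) (w : EuclideanSpace ℝ (Fin q) × (J → ℝ)), |w.2 j| ≤ ‖w‖ :=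
      fun j w => (norm_le_pi_norm w.2 j).trans (norm_snd_le w)
    have hmain := norm_deriv_deriv_oscillatingMap_le (a := a) (ξ := ξ) (L := fun j : J => L j)
      (lam := lam) (hline_e hp v) (hline_χ hp v) hξ ha ha₄
      (fun j => hL j) (hline_sum hp v) (C := C)
      (by
        refine le_trans ?_ (hpC v).2
        conv_lhs => rw [heline, deriv_deriv_continuousLinearMap_comp _ hH1]
        exact norm_fst_le _)
      (fun j => by
        refine le_trans ?_ (hpC v).1
        rw [hχline, deriv_continuousLinearMap_comp _ (hH1.differentiableAt (by simp))]
        exact hproj j _)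
      (fun j => by
        refine le_trans ?_ (hpC v).2
        rw [hχline, deriv_deriv_continuousLinearMap_comp _ hH1]
        exact hproj j _) hlam0.le
    rw [oscillatingMap_comp]
    refine hmain.trans ?_
    set ρ := ‖deriv (e ∘ chartLine p x v) 0‖ with hρ
    -- Unit speed bounds the speed `ρ` for the metric induced by `e`.
    have hρ2 : ρ ^ 2 ≤ m / (lam ^ 2 * (1 - ε) ^ 2) := by
      rw [le_div_iff₀ (by positivity)]
      rw [div_le_iff₀ hm'] at hlow
      linarith
    calc _ ≤ (lam ^ 2 * Real.sqrt (3 / (m * (m + 2))) +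
          Real.sqrt (Fintype.card J) * (C * (lam + 3 * lam))) *
            (m / (lam ^ 2 * (1 - ε) ^ 2)) := by gcongr
      _ = (Real.sqrt (3 / (m * (m + 2))) * m) / (1 - ε) ^ 2 + Q / lam := by
        rw [hQ]; field_simp; ring
      _ ≤ (S + δ / 2) + δ / 2 := by rw [hmS]; exact add_le_add hεS.le hlamQ
      _ = S + δ := by ring

/-- There are immersions in the unit ball whose curvature is arbitrarily close to
`√(3m/(m+2))`. -/
theorem exists_isSmoothImmersion_curvPerp_le (hm : 0 < m) {δ : ℝ} (hδ : 0 < δ) :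
    ∃ (N : ℕ) (f : X → EuclideanSpace ℝ (Fin N)), IsSmoothImmersion (m := m) f ∧
      (∀ x, f x ∈ Metric.closedBall (0 : EuclideanSpace ℝ (Fin N)) 1) ∧
      curvPerp (m := m) f ≤ ENNReal.ofReal (Real.sqrt (3 * (m : ℝ) / ((m : ℝ) + 2)) + δ) := by
  obtain ⟨I, _, Z, hZs, hZi, hZ1, hZ⟩ := exists_immersion_norm_deriv_deriv_le (X := X) hm hδ
  let ι := (stdOrthonormalBasis ℝ (PiLp 2 fun _ : I => ℂ)).repr.toLinearIsometry
  let f := ι ∘ Z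
  have hfs : ContMDiff (𝓡 m) 𝓘(ℝ, EuclideanSpace ℝ (Fin _)) ∞ f :=
    ι.toContinuousLinearMap.contMDiff.comp hZs
  refine ⟨_, f, ⟨hfs, fun x => injective_mfderiv_linearIsometry_comp ι hZs (hZi x)⟩,
    fun x => ?_, ?_⟩
  · rw [mem_closedBall_zero_iff]
    exact (ι.norm_map _).trans_le (hZ1 x).le
  · refine iSup_le fun γ => iSup_le fun t₁ => iSup_le fun t₂ => iSup_le fun hγ => iSup_le fun t =>
      iSup_le fun ht => ENNReal.ofReal_le_ofReal ?_
    obtain ⟨p, hp, hpZ⟩ := hZ (γ t)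
    obtain ⟨v, hv1, hv2⟩ := hγ.exists_norm_deriv_deriv_le hfs ht hp
    have h1 := contDiffAt_comp_chartLine hZs hp v
    have h2 : f ∘ chartLine p (γ t) v =
        fun s => ι.toContinuousLinearMap ((Z ∘ chartLine p (γ t) v) s) := rfl
    rw [← deriv_comp_chartLine hfs hp, h2,
      deriv_continuousLinearMap_comp _ (h1.differentiableAt (by simp))] at hv1
    rw [← deriv_deriv_comp_chartLine hfs hp, h2,
      deriv_deriv_continuousLinearMap_comp _ h1] at hv2
    exact hv2.trans ((ι.norm_map _).trans_le (hpZ v ((ι.norm_map _).symm.trans hv1)))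

end Construction

/-- A manifold of dimension zero is mapped to a point, and has no unit speed geodesics. -/
theorem minCurvPerp_zero (X : Type*) [TopologicalSpace X]
    [ChartedSpace (EuclideanSpace ℝ (Fin 0)) X] (N : ℕ) : minCurvPerp 0 X N = 0 := by
  refine le_antisymm ?_ zero_le
  refine iInf_le_of_le (fun _ => 0) (iInf_le_of_le ⟨contMDiff_const, fun x => ?_⟩
    (iInf_le_of_le (fun x => by simp) ?_))
  · intro v w _
    exact Subsingleton.elim (α := EuclideanSpace ℝ (Fin 0)) v w
  · refine iSup_le fun γ => iSup_le fun a => iSup_le fun b => iSup_le fun hγ => iSup_le fun t =>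
      iSup_le fun ht => ?_
    have := hγ.unit_speed t ht
    simp [inducedMetric, Function.comp_def] at this

theorem mainTheorem4 (m : ℕ) (X : Type*) [TopologicalSpace X] [T2Space X] [CompactSpace X]
    [ChartedSpace (EuclideanSpace ℝ (Fin m)) X] [IsManifold (𝓡 m) ∞ X] :
    (∃ L : ℝ≥0∞, Tendsto (fun N : ℕ => minCurvPerp m X N) atTop (𝓝 L) ∧
      L ≤ ENNReal.ofReal (Real.sqrt (3 * (m : ℝ) / ((m : ℝ) + 2)))) ∧
    (2 ≤ m → ∃ N₀ : ℕ, ∀ N : ℕ, N₀ ≤ N →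
      minCurvPerp m X N <
        ENNReal.ofReal (Real.sqrt (3 * (2 * (m : ℝ) - 1) / (2 * (m : ℝ) + 1)))) := by
  have hlim : Tendsto (fun N : ℕ => minCurvPerp m X N) atTop (𝓝 (⨅ N, minCurvPerp m X N)) :=
    tendsto_atTop_iInf (minCurvPerp_antitone m X)
  have hle : ⨅ N, minCurvPerp m X N ≤ ENNReal.ofReal (Real.sqrt (3 * (m : ℝ) / ((m : ℝ) + 2))) := by
    rcases Nat.eq_zero_or_pos m with rfl | hm
    · exact iInf_le_of_le 0 (by rw [minCurvPerp_zero]; exact zero_le)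
    · refine ENNReal.le_of_forall_pos_le_add fun δ hδ _ => ?_
      obtain ⟨N, f, hf, hball, hcurv⟩ :=
        exists_isSmoothImmersion_curvPerp_le (X := X) hm (δ := δ) (by exact_mod_cast hδ)
      rw [ENNReal.ofReal_add (Real.sqrt_nonneg _) δ.coe_nonneg, ENNReal.ofReal_coe_nnreal] at hcurv
      have hmin : minCurvPerp m X N ≤ curvPerp (m := m) f :=
        iInf_le_of_le f (iInf_le_of_le hf (iInf_le _ hball))
      exact (iInf_le _ N).trans (hmin.trans hcurv)
  refine ⟨⟨_, hlim, hle⟩, fun hm => ?_⟩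
  have hm' : (2 : ℝ) ≤ m := by exact_mod_cast hm
  have hlt : ENNReal.ofReal (Real.sqrt (3 * (m : ℝ) / ((m : ℝ) + 2))) <
      ENNReal.ofReal (Real.sqrt (3 * (2 * (m : ℝ) - 1) / (2 * (m : ℝ) + 1))) := by
    have h1 : 3 * (m : ℝ) / ((m : ℝ) + 2) < 3 * (2 * (m : ℝ) - 1) / (2 * (m : ℝ) + 1) := by
      rw [div_lt_div_iff₀ (by positivity) (by positivity)]
      nlinarith
    have h2 : 0 ≤ 3 * (m : ℝ) / ((m : ℝ) + 2) := by positivity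
    exact (ENNReal.ofReal_lt_ofReal_iff (Real.sqrt_pos.2 (h2.trans_lt h1))).2
      (Real.sqrt_lt_sqrt h2 h1)
  exact eventually_atTop.1 (hlim.eventually_lt_const (hle.trans_lt hlt))
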